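/- **Setting.** Let $(\mathcal V,\mathcal E)$ be a finite directed network with destination $d$, link capacities $C_{ij}\ge 0$ and unit costs $e_{ij}\ge 0$, and let $h(x)=\sum_{(i,j)\in\mathcal E}e_{ij}\sum_l x_{ij}^{(l)}$. Packets have lifetimes $l\in\{1,\dots,L\}$. In slot $t=0,1,\dots$, $a_i^{(l)}(t)\in\{0,\dots,A_{\max}\}$ packets of lifetime $l$ arrive at node $i$; the vectors $a(t)$ are i.i.d. over $t$ with mean $\lambda$, and $a_d=0$. Write $x_{i\to}^{(l)}=\sum_j x_{ij}^{(l)}$, $x_{\to i}^{(l)}=\sum_j x_{ji}^{(l)}$, $f^{(\ge l)}=\sum_{m\ge l}f^{(m)}$, $f^{(\le l)}=\sum_{m\le l}f^{(m)}$, and $\{z(t)\}$-average for $\lim_{T\to\infty}\frac1T\sum_{t<T}z(t)$. The queues start empty and satisfy $Q_d^{(l)}=0$ and, for $i\ne d$, $$Q_i^{(l)}(t+1)=Q_i^{(l+1)}(t)-x_{i\to}^{(l+1)}(t)+x_{\to i}^{(l+1)}(t)+a_i^{(l)}(t),$$ where the terms with lifetime $L+1$ are $0$. **Problem $\mathscr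 P_1$.** Decisions $x(t)\ge 0$ on the links, with $x_{ij}^{(1)}(t)=0$ for $j\neq d$, are *feasible* for $(\lambda,\gamma)$ if $x_{i\to}^{(l)}(t)\le Q_i^{(l)}(t)$ almost surely for all $i,l,t$, the averages $x_{ij}^{(l)}$ of $\mathbb E\,x_{ij}^{(l)}(t)$ (the *flow assignment*) exist, $\sum_l x_{\to d}^{(l)}\ge\gamma\|\lambda\|_1$, and $\sum_l x_{ij}^{(l)}\le C_{ij}$ on all links. The *stability region* is the set of $(\lambda,\gamma)$ with $\lambda\ge 0$, $\lambda_d=0$, $0\le\gamma\le1$ that admit feasible decisions for some such arrival process with mean $\lambda$; its interior is taken relative to the set of all these $(\lambda,\gamma)$. Let $h^\star(\lambda,\gamma)$ be the infimum of $h(x)$ over all flow assignments $x$ of feasible decisions. **Algorithm** (parameter $W>0$). The virtual queues start at $0$ and evolve by $$U_d(t+1)=\max\{U_d(t)+\gamma\textstyle\sum_{i,l}a_i^{(l)}(t)-\sum_l\nu_{\to d}^{(l)}(t),0\},$$ $$U_i^{(l)}(t+1)=\max\{U_i^{(l)}(t)+\nu_{i\to}^{(\ge l)}(t)-\nu_{\to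 i}^{(\ge l+1)}(t)-a_i^{(\ge l)}(t),0\}\quad(i\ne d).$$ In each slot the virtual flow $\nu(t)$ maximizes $\sum w_{ij}^{(l)}(t)\nu_{ij}^{(l)}$ over flows $\nu\ge0$ on the links with $\sum_l\nu_{ij}^{(l)}\le C_{ij}$ and $\nu_{dj}=0$, and vanishes where $w_{ij}^{(l)}(t)\le0$; here $$w_{ij}^{(l)}(t)=-We_{ij}-U_i^{(\le l)}(t)+\begin{cases}U_d(t)&j=d,\\U_j^{(\le l-1)}(t)&j\ne d.\end{cases}$$ Ties are broken in any non-anticipating way. With the empirical averages $\bar\nu=\frac1t\sum_{s<t}\nu(s)$, $\hat\lambda=\frac1t\sum_{s<t}a(s)$ (both $0$ at $t=0$), every packet of lifetime $l$ queued at node $i$ in slot $t$ is, independently of the other packets given the past, sent to $j$ with probability $$\hat\alpha_i^{(l)}(j)=\frac{\bar\nu_{ij}^{(l)}}{\bar\nu_{\to i}^{(\ge l+1)}+\hat\lambda_i^{(\ge l)}-\bar\nu_{i\to}^{(\ge l+1)}}\qquad(0/0=0),$$ and stays at $i$ otherwise. If $\bar\nu_{i\to}^{(\ge l)}>\bar\nu_{\to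 i}^{(\ge l+1)}+\hat\lambda_i^{(\ge l)}$, so that these numbers need not be probabilities, node $i$ either replaces the denominator by its maximum with $\bar\nu_{i\to}^{(l)}$, or keeps the probabilities of the previous slot for lifetime $l$; almost surely it does not keep them in all slots from some time on. Let $\mu(t)$ be the resulting actual flow. **Proposition.** There is a constant $B$, depending only on the network, $L$ and $A_{\max}$, such that the following holds for every $(\lambda,\gamma)$ in the interior of the stability region, every $W>0$, every arrival process as above and every run of the algorithm for which almost surely the average $\bar\nu_\infty=\lim_{T\to\infty}\frac1T\sum_{t<T}\nu(t)$ exists. The decisions $\mu(t)$ are feasible for $\mathscr P_1$ at $(\lambda,\gamma)$, with flow assignment $\mathbb E\,\bar\nu_\infty$. Almost surely $\lim_{T\to\infty}\frac1T\sum_{t<T}\mu(t)=\bar\nu_\infty$ and $\lim_{T\to\infty}\frac1T\sum_{t<T}h(\mu(t))=h(\bar\nu_\infty)$. Moreover $$\lim_{T\to\infty}\frac1T\sum_{t<T}\mathbb E\,h(\mu(t))=\mathbb E\,h(\bar\nu_\infty)\le h^\star(\lambda,\gamma)+\frac BW .$$ -/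

import Mathlib

open MeasureTheory ProbabilityTheory Filter Topology
open scoped BigOperators

namespace DelayNet

/-- A directed network with node set `V`, links `E`, destination `d`, link capacities `C` and unit
transmission costs `e`. -/
structure Network (V : Type*) where
  E : Finset (V × V)
  d : V
  C : V → V → ℝ
  e : V → V → ℝ
  C_nonneg : ∀ i j, 0 ≤ C i j
  e_nonneg : ∀ i j, 0 ≤ e i j

/- Lifetimes `1, …, L` are indexed by `Fin L`: the index `l` stands for the lifetime `l + 1`. -/

/-- Link flows: `x i j l` is the flow on the link `(i, j)` of packets with lifetime index `l`. -/
abbrev Flow (V : Type*) (L : ℕ) := V → V → Fin L → ℝ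

/-- The long-term average `lim_{T → ∞} (1/T) ∑_{t < T} z t` exists and equals `c`. -/
def HasAvg (z : ℕ → ℝ) (c : ℝ) : Prop :=
  Tendsto (fun T : ℕ => (∑ t ∈ Finset.range T, z t) / T) atTop (𝓝 c)

section

variable {V : Type*} [Fintype V] [DecidableEq V] {L : ℕ}

/-- `x_{i→}^{(l)}`. -/
def outflow (x : Flow V L) (i : V) (l : Fin L) : ℝ := ∑ j, x i j l

/-- `x_{→i}^{(l)}`. -/
def inflow (x : Flow V L) (i : V) (l : Fin L) : ℝ := ∑ j, x j i l

/-- `f^{(≥ l)}`. -/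
def geq (f : Fin L → ℝ) (l : Fin L) : ℝ := ∑ m ∈ Finset.univ.filter (fun m => l ≤ m), f m

/-- `f^{(≥ l+1)}`. -/
def gtr (f : Fin L → ℝ) (l : Fin L) : ℝ := ∑ m ∈ Finset.univ.filter (fun m => l < m), f m

/-- `f^{(≤ l)}`. -/
def leq (f : Fin L → ℝ) (l : Fin L) : ℝ := ∑ m ∈ Finset.univ.filter (fun m => m ≤ l), f m

/-- `f^{(≤ l-1)}`. -/
def lss (f : Fin L → ℝ) (l : Fin L) : ℝ := ∑ m ∈ Finset.univ.filter (fun m => m < l), f m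

/-- `f^{(l+1)}`, which is zero when `l` is the maximum lifetime. -/
def succLife (f : Fin L → ℝ) (l : Fin L) : ℝ :=
  if h : (l : ℕ) + 1 < L then f ⟨(l : ℕ) + 1, h⟩ else 0

/-- The cost `h(x) = ∑_{(i,j) ∈ E} e_{ij} x_{ij}`. -/
def cost (G : Network V) (x : Flow V L) : ℝ := ∑ p ∈ G.E, G.e p.1 p.2 * ∑ l, x p.1 p.2 l

/-- The lifetime queues, along one sample path of arrivals `a` and decisions `x`, starting empty.
Packets that reach lifetime zero leave the system, and so do packets that reach the destination. -/
def queue (G : Network V) (a : ℕ → V → Fin L → ℕ) (x : ℕ → Flow V L) : ℕ → V → Fin L → ℝ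
  | 0 => fun _ _ => 0
  | t + 1 => fun i l =>
      if i = G.d then 0
      else succLife (queue G a x t i) l - succLife (outflow (x t) i) l
        + succLife (inflow (x t) i) l + a t i l

/-- The exogenous arrivals: i.i.d. over time, bounded by `Amax`, none at the destination, with
mean arrival rates `lam`. -/
structure IsArrivalProcess {Ω : Type*} [MeasurableSpace Ω] (P : Measure Ω) (G : Network V)
    (lam : V → Fin L → ℝ) (Amax : ℕ) (a : ℕ → Ω → V → Fin L → ℕ) : Prop where
  meas : ∀ t, Measurable (a t)
  indep : iIndepFun a P
  ident : ∀ t, IdentDistrib (a t) (a 0) P P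
  bound : ∀ t, ∀ᵐ ω ∂P, ∀ i l, a t ω i l ≤ Amax
  dest : ∀ t, ∀ᵐ ω ∂P, ∀ l, a t ω G.d l = 0
  mean : ∀ i l, ∫ ω, (a 0 ω i l : ℝ) ∂P = lam i l

/-- The decisions `x` are feasible for the average-capacity-constrained problem with reliability
level `gam` and mean arrival rates `lam`, and their flow assignment, the vector of long-term
averages of the expected flows, is `xbar`. -/
structure IsFeasible {Ω : Type*} [MeasurableSpace Ω] (P : Measure Ω) (G : Network V)
    (lam : V → Fin L → ℝ) (gam : ℝ) (a : ℕ → Ω → V → Fin L → ℕ) (x : ℕ → Ω → Flow V L)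
    (xbar : Flow V L) : Prop where
  meas : ∀ t i j l, Measurable (fun ω => x t ω i j l)
  nonneg : ∀ t, ∀ᵐ ω ∂P, ∀ i j l, 0 ≤ x t ω i j l
  link : ∀ t, ∀ᵐ ω ∂P, ∀ i j l, (i, j) ∉ G.E → x t ω i j l = 0
  /-- Packets of lifetime 1 are sent to the destination only. -/
  lifetime_one : ∀ t, ∀ᵐ ω ∂P, ∀ i j (l : Fin L), (l : ℕ) = 0 → j ≠ G.d → x t ω i j l = 0
  availability : ∀ t, ∀ᵐ ω ∂P, ∀ i l,
    outflow (x t ω) i l ≤ queue G (fun s => a s ω) (fun s => x s ω) t i l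
  assignment : ∀ i j l, HasAvg (fun t => ∫ ω, x t ω i j l ∂P) (xbar i j l)
  reliability : gam * ∑ i, ∑ l, lam i l ≤ ∑ l, inflow xbar G.d l
  capacity : ∀ i j, (i, j) ∈ G.E → ∑ l, xbar i j l ≤ G.C i j

/-- The flow space: all flow assignments of feasible policies at the point `p = (lam, gam)`. -/
def flowSpace (G : Network V) (p : (V → Fin L → ℝ) × ℝ) : Set (Flow V L) :=
  {xbar | ∃ (Ω : Type) (_ : MeasurableSpace Ω) (P : Measure Ω) (Amax : ℕ)
    (a : ℕ → Ω → V → Fin L → ℕ) (x : ℕ → Ω → Flow V L), IsProbabilityMeasure P ∧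
      IsArrivalProcess P G p.1 Amax a ∧ IsFeasible P G p.1 p.2 a x xbar}

/-- The possible parameters `(lam, gam)`. -/
def paramSpace (G : Network V) (L : ℕ) : Set ((V → Fin L → ℝ) × ℝ) :=
  {p | (∀ i l, 0 ≤ p.1 i l) ∧ (∀ l, p.1 G.d l = 0) ∧ 0 ≤ p.2 ∧ p.2 ≤ 1}

/-- The stability region: the parameters that admit a feasible policy. -/
def stabilityRegion (G : Network V) (L : ℕ) : Set ((V → Fin L → ℝ) × ℝ) :=
  {p | p ∈ paramSpace G L ∧ (flowSpace G p).Nonempty}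

/-- The interior of the stability region, relative to the space of possible parameters. -/
def stabilityInterior (G : Network V) (L : ℕ) : Set ((V → Fin L → ℝ) × ℝ) :=
  {p | p ∈ paramSpace G L ∧ stabilityRegion G L ∈ 𝓝[paramSpace G L] p}

/-- The optimal cost at the point `p = (lam, gam)`. -/
noncomputable def optCost (G : Network V) (p : (V → Fin L → ℝ) × ℝ) : ℝ :=
  sInf (cost G '' flowSpace G p)

/-- The virtual queue `U_d` along one sample path of arrivals `a` and virtual flows `ν`. -/
noncomputable def destQueue (G : Network V) (gam : ℝ) (a : ℕ → V → Fin L → ℕ)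
    (ν : ℕ → Flow V L) : ℕ → ℝ
  | 0 => 0
  | t + 1 => max (destQueue G gam a ν t + gam * ∑ i, ∑ l, (a t i l : ℝ)
      - ∑ l, inflow (ν t) G.d l) 0

/-- The virtual queues `U_i^{(l)}`; only those with `i ≠ d` are used. -/
noncomputable def nodeQueue (a : ℕ → V → Fin L → ℕ) (ν : ℕ → Flow V L) : ℕ → V → Fin L → ℝ
  | 0 => fun _ _ => 0
  | t + 1 => fun i l => max (nodeQueue a ν t i l + geq (outflow (ν t) i) l
      - gtr (inflow (ν t) i) l - geq (fun m => (a t i m : ℝ)) l) 0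

/-- The weights `w_{ij}^{(l)}` for given virtual queues `Ud`, `U` and trade-off parameter `W`. -/
def weight (G : Network V) (W Ud : ℝ) (U : V → Fin L → ℝ) : Flow V L := fun i j l =>
  - W * G.e i j - leq (U i) l + (if j = G.d then Ud else lss (U j) l)

/-- The virtual flows among which a node may choose: they respect the link capacities, and the
destination sends nothing. -/
structure IsVirtualFlow (G : Network V) (y : Flow V L) : Prop where
  nonneg : ∀ i j l, 0 ≤ y i j l
  link : ∀ i j l, (i, j) ∉ G.E → y i j l = 0
  dest : ∀ j l, y G.d j l = 0
  capacity : ∀ i j, ∑ l, y i j l ≤ G.C i j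

/-- `y` is a max-weight virtual flow for the weights `w`: it maximizes `⟨w, y⟩`, and it uses only
links and lifetimes of positive weight. -/
structure IsMaxWeight (G : Network V) (w y : Flow V L) : Prop where
  flow : IsVirtualFlow G y
  maximal : ∀ z : Flow V L, IsVirtualFlow G z →
    ∑ i, ∑ j, ∑ l, w i j l * z i j l ≤ ∑ i, ∑ j, ∑ l, w i j l * y i j l
  positive : ∀ i j l, w i j l ≤ 0 → y i j l = 0

/-- The empirical average of the virtual flow before time `t`. -/
noncomputable def empFlow (ν : ℕ → Flow V L) (t : ℕ) : Flow V L := fun i j l =>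
  (∑ s ∈ Finset.range t, ν s i j l) / t

/-- The empirical arrival rates before time `t`. -/
noncomputable def empRate (a : ℕ → V → Fin L → ℕ) (t : ℕ) : V → Fin L → ℝ := fun i l =>
  (∑ s ∈ Finset.range t, (a s i l : ℝ)) / t

/-- `x_{→i}^{(≥ l+1)} + lam_i^{(≥ l)} - x_{i→}^{(≥ l+1)}`, the denominator of the routing
probabilities. -/
def supply (x : Flow V L) (lam : V → Fin L → ℝ) (i : V) (l : Fin L) : ℝ :=
  gtr (inflow x i) l + geq (lam i) l - gtr (outflow x i) l

/-- The flow conservation law at node `i` for lifetime `l`. -/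
def Conserves (x : Flow V L) (lam : V → Fin L → ℝ) (i : V) (l : Fin L) : Prop :=
  geq (outflow x i) l ≤ gtr (inflow x i) l + geq (lam i) l

/-- The routing probabilities `x_{ij}^{(l)} / supply`, `j ∈ V`. If `(x, lam)` conserves flow at
`(i, l)` then `outflow x i l ≤ supply x lam i l` and the maximum has no effect; otherwise these
numbers may not be probabilities and are rescaled to sum to one. (The quotient `0 / 0` is `0`.) -/
noncomputable def routingProb (x : Flow V L) (lam : V → Fin L → ℝ) (i : V) (l : Fin L) :
    V → ℝ := fun j => x i j l / max (supply x lam i l) (outflow x i l)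

/-- The probability of a decision: go to `j`, or stay at the node. -/
def decisionProb (p : V → ℝ) : Option V → ℝ
  | some j => p j
  | none => 1 - ∑ j, p j

/-- A run of the randomized flow-matching algorithm with trade-off parameter `W` and reliability
level `gam`. Here `ℱ t` is the information at the beginning of slot `t`, `ν` is the virtual flow,
`α t ω i l j` the probability with which node `i` sends a packet of lifetime index `l` to `j`,
`D t i l k` the decision for the `k`-th packet of lifetime index `l` at node `i` (`none` for
staying), and `μ` the actual flow. -/
structure IsFlowMatchingRun {Ω : Type*} {mΩ : MeasurableSpace Ω} (P : Measure Ω)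
    (ℱ : Filtration ℕ mΩ) (G : Network V) (W gam : ℝ) (a : ℕ → Ω → V → Fin L → ℕ)
    (ν : ℕ → Ω → Flow V L) (α : ℕ → Ω → V → Fin L → V → ℝ)
    (D : ℕ → V → Fin L → ℕ → Ω → Option V) (μ : ℕ → Ω → Flow V L) : Prop where
  arrivals_observed : ∀ t, Measurable[ℱ (t + 1)] (a t)
  decisions_observed : ∀ t i l k o, MeasurableSet[ℱ (t + 1)] {ω | D t i l k ω = o}
  virtual_adapted : ∀ t i j l, Measurable[ℱ t] (fun ω => ν t ω i j l)
  prob_adapted : ∀ t i l j, Measurable[ℱ t] (fun ω => α t ω i l j)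
  /-- The virtual flow is a max-weight solution for the current virtual queues. -/
  virtual_flow : ∀ t ω, IsMaxWeight G
    (weight G W (destQueue G gam (fun s => a s ω) (fun s => ν s ω) t)
      (nodeQueue (fun s => a s ω) (fun s => ν s ω) t)) (ν t ω)
  /-- The probabilities are computed from the empirical averages. When these violate the flow
  conservation law, a node may also keep its previous probabilities, -/
  prob_rule : ∀ t ω i l,
    α t ω i l = routingProb (empFlow (fun s => ν s ω) t) (empRate (fun s => a s ω) t) i l ∨
    (0 < t ∧ α t ω i l = α (t - 1) ω i l ∧
      ¬ Conserves (empFlow (fun s => ν s ω) t) (empRate (fun s => a s ω) t) i l)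
  /-- but not for ever. -/
  prob_updated : ∀ᵐ ω ∂P, ∀ i l, ∃ᶠ t in atTop,
    α t ω i l = routingProb (empFlow (fun s => ν s ω) t) (empRate (fun s => a s ω) t) i l
  /-- Given `ℱ t`, the decisions for the individual packets are independent with the
  probabilities `α`, and they and `ℱ t` are independent of the arrivals in slot `t`. -/
  decision_law : ∀ (t : ℕ) (F : Set Ω), MeasurableSet[ℱ t] F →
    ∀ (B : Set (V → Fin L → ℕ)) (S : Finset (V × Fin L × ℕ)) (o : V × Fin L × ℕ → Option V),
      P.real (F ∩ {ω | a t ω ∈ B} ∩ {ω | ∀ s ∈ S, D t s.1 s.2.1 s.2.2 ω = o s}) =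
        P.real {ω | a t ω ∈ B} *
          ∫ ω in F, (∏ s ∈ S, decisionProb (α t ω s.1 s.2.1) (o s)) ∂P
  /-- The actual flow counts the packets in the queue that are sent over the link. -/
  actual_flow : ∀ t ω i j l, μ t ω i j l =
    if (i, j) ∈ G.E then
      (((Finset.range ⌊queue G (fun s => a s ω) (fun s => μ s ω) t i l⌋₊).filter
        (fun k => D t i l k ω = some j)).card : ℝ)
    else 0

end

end DelayNet

open DelayNet

/-! The algorithm and the feasible decisions are compared through static flows (`IsStaticFlow`):
link flows that respect the capacities, the conservation of lifetime tails at each node, and the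
reliability level. Averaging the queue recursion from the largest lifetime downwards, `hasAvg_queue`
identifies the mean queue of a lifetime with `supply`. Since the outflow never exceeds the queue,
every feasible flow assignment is static (`IsFeasible.isStaticFlow`), so it is enough to compete
with static flows.

For the virtual queues this is a drift-plus-penalty argument. After an exchange of sums, `W` times
the cost plus the first-order drift of the squared queues is affine in the virtual flow with
coefficients `-w` (`driftPairing_eq`). Max-weight therefore does at least as well as any static
flow, up to a constant from the bounded increments and a term in `a(t) - lam` that has mean zero
given the past. Summed over time (`IsFlowMatchingRun.integral_lyapunov_le`), this yields two facts:
the cost gap is `O(1/W)`, and the virtual queues have second moments `O(T)`. By the second fact the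
queues divided by `T` vanish in mean square, so the average virtual flow is almost surely static
(`average_nonpos_of_sq_growth`).

It remains to see that the actual flow has the same average. A strong law for martingale differences
shows that on average it equals queue times routing probability
(`IsFlowMatchingRun.hasAvg_actual_sub`). By downward induction on the lifetime, the averages at
larger lifetimes make the mean queue equal to `supply`, while the probabilities tend to flow over
`supply`; the product is the average virtual flow (`IsFlowMatchingRun.hasAvg_actual`). -/

namespace DelayNet

/-! ### Calculus of long-term averages. -/

section Averages

theorem HasAvg.unique {z : ℕ → ℝ} {c c' : ℝ} (h : HasAvg z c) (h' : HasAvg z c') : c = c' :=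
  tendsto_nhds_unique h h'

theorem HasAvg.add {z z' : ℕ → ℝ} {c c' : ℝ} (h : HasAvg z c) (h' : HasAvg z' c') :
    HasAvg (fun t => z t + z' t) (c + c') := by
  unfold HasAvg at *
  simpa only [Finset.sum_add_distrib, add_div] using Tendsto.add h h'

theorem HasAvg.sub {z z' : ℕ → ℝ} {c c' : ℝ} (h : HasAvg z c) (h' : HasAvg z' c') :
    HasAvg (fun t => z t - z' t) (c - c') := by
  unfold HasAvg at *
  simpa only [Finset.sum_sub_distrib, sub_div] using Tendsto.sub h h'

theorem HasAvg.const_mul {z : ℕ → ℝ} {c : ℝ} (b : ℝ) (h : HasAvg z c) :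
    HasAvg (fun t => b * z t) (b * c) := by
  unfold HasAvg at *
  simpa only [← Finset.mul_sum, mul_div_assoc] using Tendsto.const_mul b h

theorem HasAvg.sum {ι : Type*} (s : Finset ι) {z : ι → ℕ → ℝ} {c : ι → ℝ}
    (h : ∀ i ∈ s, HasAvg (z i) (c i)) : HasAvg (fun t => ∑ i ∈ s, z i t) (∑ i ∈ s, c i) := by
  unfold HasAvg at *
  have := tendsto_finsetSum s h
  refine this.congr fun T => ?_
  rw [Finset.sum_comm, Finset.sum_div]

theorem HasAvg.of_tendsto {z : ℕ → ℝ} {c : ℝ} (h : Tendsto z atTop (𝓝 c)) : HasAvg z c := by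
  refine h.cesaro.congr fun T => ?_
  rw [div_eq_inv_mul]

theorem hasAvg_const (c : ℝ) : HasAvg (fun _ => c) c := HasAvg.of_tendsto tendsto_const_nhds

/-- The queue recursions determine the value in slot `t + 1`; the first term, which they omit, is
negligible in the average. -/
theorem HasAvg.of_succ {z : ℕ → ℝ} {c : ℝ} (h : HasAvg (fun t => z (t + 1)) c) : HasAvg z c := by
  unfold HasAvg at *
  rw [← tendsto_add_atTop_iff_nat 1]
  have h1 : Tendsto (fun T : ℕ => (T : ℝ) / ((T : ℝ) + 1)) atTop (𝓝 1) :=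
    tendsto_natCast_div_add_atTop 1
  have h2 : Tendsto (fun T : ℕ => z 0 * (1 / ((T : ℝ) + 1))) atTop (𝓝 (z 0 * 0)) :=
    tendsto_one_div_add_atTop_nhds_zero_nat.const_mul _
  have h3 := (h.mul h1).add h2
  rw [mul_one, mul_zero, add_zero] at h3
  refine h3.congr fun T => ?_
  rw [Finset.sum_range_succ']
  rcases Nat.eq_zero_or_pos T with rfl | hT
  · simp
  · have : (T : ℝ) ≠ 0 := by positivity
    push_cast
    field_simp

theorem HasAvg.squeeze_zero {y z : ℕ → ℝ} (h : HasAvg z 0) (h0 : ∀ t, 0 ≤ y t)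
    (hyz : ∀ t, y t ≤ z t) : HasAvg y 0 := by
  refine _root_.squeeze_zero (fun T => ?_) (fun T => ?_) h
  · exact div_nonneg (Finset.sum_nonneg fun t _ => h0 t) (Nat.cast_nonneg _)
  · exact div_le_div_of_nonneg_right (Finset.sum_le_sum fun t _ => hyz t) (Nat.cast_nonneg _)

/-- The error `q t * (z t - a)` tends to zero because `q` is bounded. In the application `q` is a
queue, which need not converge, and `z` a routing probability, which does. -/
theorem HasAvg.mul_bounded {z q : ℕ → ℝ} {a c K : ℝ} (hz : Tendsto z atTop (𝓝 a))
    (hq : HasAvg q c) (hK : ∀ t, |q t| ≤ K) : HasAvg (fun t => q t * z t) (c * a) := by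
  have h1 : Tendsto (fun t => q t * (z t - a)) atTop (𝓝 0) := by
    have h2 : Tendsto (fun t => K * |z t - a|) atTop (𝓝 (K * |a - a|)) :=
      ((hz.sub_const a).abs).const_mul K
    rw [sub_self, abs_zero, mul_zero] at h2
    refine squeeze_zero_norm (fun t => ?_) h2
    rw [Real.norm_eq_abs, abs_mul]
    exact mul_le_mul_of_nonneg_right (hK t) (abs_nonneg _)
  have h3 := (HasAvg.of_tendsto h1).add (hq.const_mul a)
  rw [zero_add, mul_comm a c] at h3
  refine h3.congr fun T => ?_
  congr 1
  exact Finset.sum_congr rfl fun t _ => by ring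

theorem HasAvg.le {y z : ℕ → ℝ} {b c : ℝ} (hy : HasAvg y b) (hz : HasAvg z c)
    (hyz : ∀ t, y t ≤ z t) : b ≤ c :=
  le_of_tendsto_of_tendsto' hy hz fun _ =>
    div_le_div_of_nonneg_right (Finset.sum_le_sum fun t _ => hyz t) (Nat.cast_nonneg _)

theorem abs_sum_range_div_le {z : ℕ → ℝ} {K : ℝ} (hK : ∀ t, |z t| ≤ K) (T : ℕ) :
    |(∑ t ∈ Finset.range T, z t) / T| ≤ K := by
  have hK0 : 0 ≤ K := (abs_nonneg _).trans (hK 0)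
  rw [abs_div, Nat.abs_cast]
  refine div_le_of_le_mul₀ (Nat.cast_nonneg _) hK0 ?_
  refine (Finset.abs_sum_le_sum_abs _ _).trans ((Finset.sum_le_sum fun t _ => hK t).trans ?_)
  simp [mul_comm]

/-- Dominated convergence for the Cesàro means, which inherit the bound `K`. -/
theorem hasAvg_integral {Ω : Type*} [MeasurableSpace Ω] {P : Measure Ω} [IsProbabilityMeasure P]
    {z : ℕ → Ω → ℝ} {c : Ω → ℝ} {K : ℝ} (hm : ∀ t, Measurable (z t))
    (hK : ∀ᵐ ω ∂P, ∀ t, |z t ω| ≤ K) (h : ∀ᵐ ω ∂P, HasAvg (fun t => z t ω) (c ω)) :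
    HasAvg (fun t => ∫ ω, z t ω ∂P) (∫ ω, c ω ∂P) := by
  have hi : ∀ t, Integrable (z t) P := fun t =>
    Integrable.of_bound (hm t).aestronglyMeasurable K (hK.mono fun ω hω => hω t)
  have := tendsto_integral_of_dominated_convergence (μ := P)
    (F := fun (T : ℕ) ω => (∑ t ∈ Finset.range T, z t ω) / T) (f := c) (fun _ => K)
    (fun T => ((Finset.measurable_fun_sum _ fun t _ => hm t).div_const _).aestronglyMeasurable)
    (integrable_const K) (fun T => hK.mono fun ω hω => abs_sum_range_div_le hω T) h
  refine this.congr fun T => ?_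
  rw [integral_div, integral_finsetSum _ fun t _ => hi t]

theorem integrable_of_hasAvg {Ω : Type*} [MeasurableSpace Ω] {P : Measure Ω}
    [IsProbabilityMeasure P] {z : ℕ → Ω → ℝ} {c : Ω → ℝ} {K : ℝ}
    (hm : ∀ t, Measurable (z t)) (hK : ∀ᵐ ω ∂P, ∀ t, |z t ω| ≤ K)
    (h : ∀ᵐ ω ∂P, HasAvg (fun t => z t ω) (c ω)) : Integrable c P := by
  have hc : AEStronglyMeasurable c P := aestronglyMeasurable_of_tendsto_ae atTop
    (f := fun (T : ℕ) ω => (∑ t ∈ Finset.range T, z t ω) / T)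
    (fun T => ((Finset.measurable_fun_sum _ fun t _ => hm t).div_const _).aestronglyMeasurable) h
  refine Integrable.of_bound hc K ?_
  filter_upwards [hK, h] with ω hω hc
  exact le_of_tendsto' (Tendsto.abs hc) fun T => abs_sum_range_div_le hω T

end Averages

/-! ### Strong law for martingale differences, and averages of slowly growing processes. -/

section LargeNumbers

variable {Ω : Type*} {mΩ : MeasurableSpace Ω} {P : Measure Ω} [IsProbabilityMeasure P]

/-- The last hypothesis says that `Y` has conditional expectation zero given `m`, and `X` can be
pulled out. Stating it with set integrals matches the form of `decision_law`. -/
theorem integral_mul_eq_zero_of_setIntegral {m : MeasurableSpace Ω} (hm : m ≤ mΩ) {X Y : Ω → ℝ}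
    (hX : Measurable[m] X) (hXY : Integrable (fun ω => X ω * Y ω) P) (hY : Integrable Y P)
    (h0 : ∀ F, MeasurableSet[m] F → ∫ ω in F, Y ω ∂P = 0) : ∫ ω, X ω * Y ω ∂P = 0 := by
  have h1 : P[Y|m] =ᵐ[P] 0 := by
    refine (ae_eq_condExp_of_forall_setIntegral_eq hm hY (fun _ _ _ => integrableOn_zero)
      (fun F hF _ => ?_) aestronglyMeasurable_zero).symm
    simp [h0 F hF]
  have h2 : P[fun ω => X ω * Y ω|m] =ᵐ[P] X * P[Y|m] :=
    condExp_mul_of_stronglyMeasurable_left hX.stronglyMeasurable hXY hY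
  rw [← integral_condExp hm, integral_congr_ae (g := fun _ => 0), integral_zero]
  filter_upwards [h1, h2] with ω h1 h2
  simp [h2, h1]

/-- If `n` is the integer square root of `T`, then `T` exceeds `n ^ 2` by at most `2 * n`, so unit
steps move `S` by at most `2 * n`, which is small compared with `n ^ 2 ≤ T`. -/
theorem tendsto_div_of_tendsto_sq {S : ℕ → ℝ} (hS : ∀ n, |S (n + 1) - S n| ≤ 1)
    (h : Tendsto (fun n : ℕ => S (n ^ 2) / (n : ℝ) ^ 2) atTop (𝓝 0)) :
    Tendsto (fun n : ℕ => S n / n) atTop (𝓝 0) := by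
  have hstep : ∀ n k, |S (n + k) - S n| ≤ k := by
    intro n k
    induction k with
    | zero => simp
    | succ k ih =>
      have h1 := abs_add_le (S (n + k + 1) - S (n + k)) (S (n + k) - S n)
      rw [sub_add_sub_cancel] at h1
      rw [← add_assoc]
      push_cast
      linarith [hS (n + k)]
  have hsqrt : Tendsto Nat.sqrt atTop atTop := by
    refine tendsto_atTop_atTop.2 fun b => ⟨b ^ 2, fun a ha => ?_⟩
    exact Nat.le_sqrt'.2 ha
  have h2 : Tendsto (fun n : ℕ => |S (n ^ 2) / (n : ℝ) ^ 2| + 2 * (1 / (n : ℝ))) atTop (𝓝 0) := by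
    have := h.abs.add (tendsto_one_div_atTop_nhds_zero_nat.const_mul (2 : ℝ))
    simpa using this
  refine squeeze_zero_norm' ?_ (h2.comp hsqrt)
  filter_upwards [eventually_ge_atTop 1] with T hT
  set n := Nat.sqrt T with hn
  have hn1 : 1 ≤ n := by rw [hn]; exact Nat.le_sqrt.2 (by simpa using hT)
  have hle : n ^ 2 ≤ T := Nat.sqrt_le' T
  have hge : T ≤ n * n + n + n := Nat.sqrt_le_add T
  have h3 := hstep (n ^ 2) (T - n ^ 2)
  rw [Nat.add_sub_cancel' hle, Nat.cast_sub hle] at h3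
  have h3' : |S T - S (n ^ 2)| ≤ 2 * n := by
    have : (T : ℝ) ≤ n * n + n + n := by exact_mod_cast hge
    push_cast at h3
    nlinarith
  have hn0 : (0 : ℝ) < n := by exact_mod_cast hn1
  have hle' : (n : ℝ) ^ 2 ≤ T := by exact_mod_cast hle
  have h4 : |S T| ≤ |S (n ^ 2)| + 2 * n := by
    have := abs_add_le (S (n ^ 2)) (S T - S (n ^ 2))
    rw [add_sub_cancel] at this
    linarith
  simp only [Function.comp, Real.norm_eq_abs]
  rw [abs_div, abs_div, Nat.abs_cast, abs_of_nonneg (sq_nonneg (n : ℝ)), ← hn]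
  calc |S T| / T ≤ (|S (n ^ 2)| + 2 * n) / (n : ℝ) ^ 2 :=
        div_le_div₀ (by positivity) h4 (by positivity) hle'
    _ = _ := by field_simp

/-- The strong law of large numbers for bounded martingale differences. -/
theorem hasAvg_zero_of_martingale_difference (ℱ : Filtration ℕ mΩ) {X : ℕ → Ω → ℝ}
    (hX : ∀ t, Measurable[ℱ (t + 1)] (X t)) (hb : ∀ t, ∀ᵐ ω ∂P, |X t ω| ≤ 1)
    (h0 : ∀ t F, MeasurableSet[ℱ t] F → ∫ ω in F, X t ω ∂P = 0) :
    ∀ᵐ ω ∂P, HasAvg (fun t => X t ω) 0 := by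
  have hXm : ∀ t, Measurable (X t) := fun t => (hX t).mono (ℱ.le _) le_rfl
  set S : ℕ → Ω → ℝ := fun T ω => ∑ t ∈ Finset.range T, X t ω with hSdef
  have hSm : ∀ T, Measurable[ℱ T] (S T) := fun T => by
    refine Finset.measurable_fun_sum _ fun t ht => ?_
    exact (hX t).mono (ℱ.mono (Finset.mem_range.1 ht)) le_rfl
  have hSm' : ∀ T, Measurable (S T) := fun T => (hSm T).mono (ℱ.le _) le_rfl
  have hb' : ∀ᵐ ω ∂P, ∀ t, |X t ω| ≤ 1 := ae_all_iff.2 hb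
  have hSb : ∀ T, ∀ᵐ ω ∂P, |S T ω| ≤ T := fun T => by
    filter_upwards [hb'] with ω hω
    refine (Finset.abs_sum_le_sum_abs _ _).trans ((Finset.sum_le_sum fun t _ => hω t).trans ?_)
    simp
  have hXi : ∀ t, Integrable (X t) P := fun t =>
    Integrable.of_bound (hXm t).aestronglyMeasurable 1 (hb t)
  have hSXi : ∀ t, Integrable (fun ω => S t ω * X t ω) P := fun t =>
    (hXi t).bdd_mul (hSm' t).aestronglyMeasurable (hSb t)
  have hX2i : ∀ t, Integrable (fun ω => X t ω ^ 2) P := fun t => by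
    refine Integrable.of_bound ((hXm t).pow_const 2).aestronglyMeasurable 1 ?_
    filter_upwards [hb t] with ω hω
    rw [Real.norm_eq_abs, abs_pow]
    exact pow_le_one₀ (abs_nonneg _) hω
  have hS2i : ∀ T, Integrable (fun ω => S T ω ^ 2) P := fun T => by
    refine Integrable.of_bound ((hSm' T).pow_const 2).aestronglyMeasurable ((T : ℝ) ^ 2) ?_
    filter_upwards [hSb T] with ω hω
    rw [Real.norm_eq_abs, abs_pow]
    exact pow_le_pow_left₀ (abs_nonneg _) hω 2
  -- Martingale increments are orthogonal, so each slot adds at most 1 to the second moment.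
  have hvar : ∀ T, ∫ ω, S T ω ^ 2 ∂P ≤ T := by
    intro T
    induction T with
    | zero => simp [hSdef]
    | succ T ih =>
      have h1 : ∀ ω, S (T + 1) ω ^ 2 = S T ω ^ 2 + 2 * (S T ω * X T ω) + X T ω ^ 2 := fun ω => by
        simp only [hSdef, Finset.sum_range_succ]
        ring
      have h2 : ∫ ω, X T ω ^ 2 ∂P ≤ 1 := by
        have := integral_mono_ae (hX2i T) (integrable_const (1 : ℝ)) (by
          filter_upwards [hb T] with ω hω
          rw [← sq_abs]
          exact pow_le_one₀ (abs_nonneg _) hω)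
        simpa using this
      simp_rw [h1]
      have h3 : Integrable (fun ω => S T ω ^ 2 + 2 * (S T ω * X T ω)) P :=
        (hS2i T).add ((hSXi T).const_mul 2)
      rw [integral_add h3 (hX2i T),
        integral_add (hS2i T) ((hSXi T).const_mul 2), integral_const_mul,
        integral_mul_eq_zero_of_setIntegral (ℱ.le T) (hSm T) (hSXi T) (hXi T) (h0 T)]
      push_cast
      linarith
  -- Along the squares the second moments are at most `1 / n ^ 2`, hence summable; the series of
  -- squares is then almost surely finite and its terms tend to zero.
  have hsq : ∀ᵐ ω ∂P, Tendsto (fun n : ℕ => S (n ^ 2) ω / (n : ℝ) ^ 2) atTop (𝓝 0) := by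
    have hlin : ∀ n : ℕ, ∫⁻ ω, ENNReal.ofReal ((S (n ^ 2) ω / (n : ℝ) ^ 2) ^ 2) ∂P
        ≤ ENNReal.ofReal (1 / (n : ℝ) ^ 2) := fun n => by
      have e : ∀ ω, (S (n ^ 2) ω / (n : ℝ) ^ 2) ^ 2 = S (n ^ 2) ω ^ 2 / ((n : ℝ) ^ 2) ^ 2 :=
        fun ω => by rw [div_pow]
      simp_rw [e]
      rw [← ofReal_integral_eq_lintegral_ofReal ((hS2i _).div_const _)
        (ae_of_all _ fun ω => by positivity), integral_div]
      refine ENNReal.ofReal_le_ofReal ?_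
      have := hvar (n ^ 2)
      push_cast at this
      rcases Nat.eq_zero_or_pos n with rfl | hn
      · simp
      · have : (0 : ℝ) < n := by exact_mod_cast hn
        rw [div_le_div_iff₀ (by positivity) (by positivity)]
        nlinarith [sq_nonneg ((n : ℝ) ^ 2)]
    have hmeas : ∀ n : ℕ, Measurable fun ω => ENNReal.ofReal ((S (n ^ 2) ω / (n : ℝ) ^ 2) ^ 2) :=
      fun n => (((hSm' _).div_const _).pow_const 2).ennreal_ofReal
    have hsum : ∫⁻ ω, ∑' n : ℕ, ENNReal.ofReal ((S (n ^ 2) ω / (n : ℝ) ^ 2) ^ 2) ∂P ≠ ⊤ := by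
      rw [lintegral_tsum fun n => (hmeas n).aemeasurable]
      refine ne_top_of_le_ne_top ?_ (ENNReal.tsum_le_tsum hlin)
      exact (Real.summable_one_div_nat_pow.2 one_lt_two).tsum_ofReal_ne_top
    filter_upwards [ae_lt_top (Measurable.tsum hmeas) hsum] with ω hω
    have h1 := ENNReal.tendsto_atTop_zero_of_tsum_ne_top hω.ne
    have h2 := (ENNReal.tendsto_toReal ENNReal.zero_ne_top).comp h1
    have h3 : Tendsto (fun n : ℕ => (S (n ^ 2) ω / (n : ℝ) ^ 2) ^ 2) atTop (𝓝 0) := by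
      refine h2.congr fun n => ?_
      exact ENNReal.toReal_ofReal (sq_nonneg _)
    have h4 := h3.sqrt
    rw [Real.sqrt_zero] at h4
    simp_rw [Real.sqrt_sq_eq_abs] at h4
    exact (tendsto_zero_iff_abs_tendsto_zero _).2 h4
  filter_upwards [hsq, hb'] with ω h1 h2
  refine tendsto_div_of_tendsto_sq (S := fun n => S n ω) (fun n => ?_) h1
  simpa [hSdef, Finset.sum_range_succ] using h2 n

/-- If the drift `Δ` of a nonnegative process `U` has an average and `U` grows at most like the
square root of time in mean square, then the average is nonpositive. -/
theorem average_nonpos_of_sq_growth {Δ U : ℕ → Ω → ℝ} {c : Ω → ℝ} {M K : ℝ}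
    (hm : ∀ t, Measurable (Δ t)) (hM : ∀ᵐ ω ∂P, ∀ t, |Δ t ω| ≤ M)
    (hU : ∀ᵐ ω ∂P, ∀ T, ∑ t ∈ Finset.range T, Δ t ω ≤ U T ω) (hU0 : ∀ T ω, 0 ≤ U T ω)
    (hU2 : ∀ T, Integrable (fun ω => U T ω ^ 2) P) (hK : ∀ T : ℕ, ∫ ω, U T ω ^ 2 ∂P ≤ K * T)
    (hc : ∀ᵐ ω ∂P, HasAvg (fun t => Δ t ω) (c ω)) : ∀ᵐ ω ∂P, c ω ≤ 0 := by
  set A : ℕ → Ω → ℝ := fun T ω => (∑ t ∈ Finset.range T, Δ t ω) / T with hA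
  have hAm : ∀ T, Measurable (A T) := fun T =>
    (Finset.measurable_fun_sum _ fun t _ => hm t).div_const _
  have hcm : AEStronglyMeasurable c P := aestronglyMeasurable_of_tendsto_ae atTop
    (fun T => (hAm T).aestronglyMeasurable) hc
  have hAb : ∀ T, ∀ᵐ ω ∂P, ‖(max (A T ω) 0) ^ 2‖ ≤ M ^ 2 := fun T => by
    filter_upwards [hM] with ω hω
    have h1 := abs_sum_range_div_le hω T
    have h2 : |max (A T ω) 0| ≤ M := by
      rw [abs_of_nonneg (le_max_right _ _)]
      exact max_le ((le_abs_self _).trans h1) ((abs_nonneg _).trans h1)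
    rw [Real.norm_eq_abs, abs_pow]
    exact pow_le_pow_left₀ (abs_nonneg _) h2 2
  have hAi : ∀ T, Integrable (fun ω => (max (A T ω) 0) ^ 2) P := fun T =>
    Integrable.of_bound (((hAm T).max measurable_const).pow_const 2).aestronglyMeasurable _ (hAb T)
  have hlim : ∀ᵐ ω ∂P, Tendsto (fun T => (max (A T ω) 0) ^ 2) atTop (𝓝 ((max (c ω) 0) ^ 2)) := by
    filter_upwards [hc] with ω hω
    exact (Tendsto.max hω tendsto_const_nhds).pow 2
  have h1 : Tendsto (fun T => ∫ ω, (max (A T ω) 0) ^ 2 ∂P) atTop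
      (𝓝 (∫ ω, (max (c ω) 0) ^ 2 ∂P)) :=
    tendsto_integral_of_dominated_convergence (fun _ => M ^ 2)
      (fun T => (hAi T).aestronglyMeasurable) (integrable_const _) hAb hlim
  have hci : Integrable (fun ω => (max (c ω) 0) ^ 2) P := by
    refine Integrable.of_bound ((hcm.sup aestronglyMeasurable_const).pow 2) (M ^ 2) ?_
    filter_upwards [hlim, ae_all_iff.2 hAb] with ω h2 h3
    exact le_of_tendsto' h2.norm h3
  -- Only an upper bound `U T / T` for the average is available, hence the positive part. Its second
  -- moment is at most `K / T`, whereas by `h1` it converges to that of the positive part of `c`.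
  have h2 : Tendsto (fun T => ∫ ω, (max (A T ω) 0) ^ 2 ∂P) atTop (𝓝 0) := by
    have h3 : Tendsto (fun T : ℕ => K * (1 / (T : ℝ))) atTop (𝓝 (K * 0)) :=
      tendsto_one_div_atTop_nhds_zero_nat.const_mul K
    rw [mul_zero] at h3
    refine squeeze_zero' (Eventually.of_forall fun T => integral_nonneg fun ω => sq_nonneg _) ?_ h3
    filter_upwards [eventually_gt_atTop 0] with T hT
    have hT' : (0 : ℝ) < T := by exact_mod_cast hT
    calc ∫ ω, (max (A T ω) 0) ^ 2 ∂P ≤ ∫ ω, U T ω ^ 2 / (T : ℝ) ^ 2 ∂P := by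
          refine integral_mono_ae (hAi T) ((hU2 T).div_const _) ?_
          filter_upwards [hU] with ω hω
          rw [← div_pow]
          refine pow_le_pow_left₀ (le_max_right _ _) (max_le ?_ ?_) 2
          · exact div_le_div_of_nonneg_right (hω T) hT'.le
          · exact div_nonneg (hU0 T ω) hT'.le
      _ ≤ K * T / (T : ℝ) ^ 2 := by
          rw [integral_div]
          exact div_le_div_of_nonneg_right (hK T) (by positivity)
      _ = K * (1 / (T : ℝ)) := by field_simp
  have h3 : ∫ ω, (max (c ω) 0) ^ 2 ∂P = 0 := tendsto_nhds_unique h1 h2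
  have h4 := (integral_eq_zero_iff_of_nonneg (fun ω => sq_nonneg _) hci).1 h3
  filter_upwards [h4] with ω hω
  have : max (c ω) 0 = 0 := by simpa using hω
  exact max_eq_right_iff.1 this

end LargeNumbers

/-! ### Sums over lifetimes and the steady state of the lifetime recursion. -/

section Lifetimes

variable {L : ℕ}

theorem geq_eq_add_gtr (f : Fin L → ℝ) (l : Fin L) : geq f l = f l + gtr f l := by
  unfold geq gtr
  rw [← Finset.sum_insert (by simp)]
  congr 1
  ext m
  simp [le_iff_eq_or_lt, eq_comm]

/-- Translates between the shift by one lifetime in the queue recursion and the strict tails in the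
conservation law; at the largest lifetime both sides vanish. -/
theorem gtr_eq_succLife_geq (f : Fin L → ℝ) (l : Fin L) : gtr f l = succLife (geq f) l := by
  unfold succLife
  split_ifs with h
  · unfold geq gtr
    congr 1
  · unfold gtr
    refine Finset.sum_eq_zero fun m hm => ?_
    have : (l : ℕ) < m := (Finset.mem_filter.1 hm).2
    omega

/-- Summation by parts. This and `sum_mul_gtr` turn drifts stated with lifetime tails into weights
stated with partial sums of the queues. -/
theorem sum_mul_geq (u f : Fin L → ℝ) : ∑ l, u l * geq f l = ∑ l, f l * leq u l := by
  simp only [geq, leq, Finset.mul_sum, Finset.sum_filter]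
  rw [Finset.sum_comm]
  refine Finset.sum_congr rfl fun m _ => Finset.sum_congr rfl fun l _ => ?_
  split_ifs <;> ring

theorem sum_mul_gtr (u f : Fin L → ℝ) : ∑ l, u l * gtr f l = ∑ l, f l * lss u l := by
  simp only [gtr, lss, Finset.mul_sum, Finset.sum_filter]
  rw [Finset.sum_comm]
  refine Finset.sum_congr rfl fun m _ => Finset.sum_congr rfl fun l _ => ?_
  split_ifs <;> ring

theorem geq_nonneg {f : Fin L → ℝ} (hf : ∀ l, 0 ≤ f l) (l : Fin L) : 0 ≤ geq f l :=
  Finset.sum_nonneg fun m _ => hf m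

theorem gtr_nonneg {f : Fin L → ℝ} (hf : ∀ l, 0 ≤ f l) (l : Fin L) : 0 ≤ gtr f l :=
  Finset.sum_nonneg fun m _ => hf m

theorem leq_nonneg {f : Fin L → ℝ} (hf : ∀ l, 0 ≤ f l) (l : Fin L) : 0 ≤ leq f l :=
  Finset.sum_nonneg fun m _ => hf m

theorem geq_le_sum {f : Fin L → ℝ} (hf : ∀ l, 0 ≤ f l) (l : Fin L) : geq f l ≤ ∑ m, f m :=
  Finset.sum_le_sum_of_subset_of_nonneg (Finset.filter_subset _ _) fun m _ _ => hf m

theorem gtr_le_sum {f : Fin L → ℝ} (hf : ∀ l, 0 ≤ f l) (l : Fin L) : gtr f l ≤ ∑ m, f m :=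
  Finset.sum_le_sum_of_subset_of_nonneg (Finset.filter_subset _ _) fun m _ _ => hf m

theorem HasAvg.geq {f : ℕ → Fin L → ℝ} {c : Fin L → ℝ}
    (h : ∀ m, HasAvg (fun t => f t m) (c m)) (l : Fin L) :
    HasAvg (fun t => geq (f t) l) (geq c l) := HasAvg.sum _ fun m _ => h m

theorem HasAvg.gtr {f : ℕ → Fin L → ℝ} {c : Fin L → ℝ}
    (h : ∀ m, HasAvg (fun t => f t m) (c m)) (l : Fin L) :
    HasAvg (fun t => gtr (f t) l) (gtr c l) := HasAvg.sum _ fun m _ => h m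

theorem HasAvg.succLife {f : ℕ → Fin L → ℝ} {c : Fin L → ℝ} {l : Fin L}
    (h : ∀ m, l < m → HasAvg (fun t => f t m) (c m)) :
    HasAvg (fun t => succLife (f t) l) (succLife c l) := by
  unfold DelayNet.succLife
  split_ifs with hl
  · exact h _ (Fin.lt_def.2 (Nat.lt_succ_self _))
  · exact hasAvg_const 0

/-- In the long run, the queue of lifetime `l` equals the flow that arrives with lifetime at least
`l` and has not left with a larger lifetime. -/
theorem hasAvg_queue {q o n b : ℕ → Fin L → ℝ} {obar nbar bbar : Fin L → ℝ}
    (hq : ∀ t l, q (t + 1) l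
      = succLife (q t) l - succLife (o t) l + succLife (n t) l + b t l)
    (hb : ∀ l, HasAvg (fun t => b t l) (bbar l)) (l : Fin L)
    (ho : ∀ m, l < m → HasAvg (fun t => o t m) (obar m))
    (hn : ∀ m, l < m → HasAvg (fun t => n t m) (nbar m)) :
    HasAvg (fun t => q t l) (gtr nbar l + geq bbar l - gtr obar l) := by
  -- Downward induction on the lifetime: `k` bounds the distance of `l` from `L`, and for `k = 0` no
  -- index remains.
  suffices H : ∀ k : ℕ, ∀ l : Fin L, L ≤ l + k →
      (∀ m, l < m → HasAvg (fun t => o t m) (obar m)) →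
      (∀ m, l < m → HasAvg (fun t => n t m) (nbar m)) →
      HasAvg (fun t => q t l) (gtr nbar l + geq bbar l - gtr obar l) from
    H L l (Nat.le_add_left _ _) ho hn
  intro k
  induction k with
  | zero => intro l hl; have := l.isLt; omega
  | succ k ih =>
    intro l hl ho hn
    -- The claimed limit satisfies the time-averaged form of the recursion `hq`.
    have e : gtr nbar l + geq bbar l - gtr obar l
        = succLife (fun m => gtr nbar m + geq bbar m - gtr obar m) l - succLife obar l
          + succLife nbar l + bbar l := by
      rw [geq_eq_add_gtr bbar l]
      simp only [gtr_eq_succLife_geq _ l, succLife]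
      split_ifs
      · simp only [geq_eq_add_gtr]
        ring
      · ring
    rw [e]
    refine HasAvg.of_succ ?_
    simp only [hq]
    refine ((HasAvg.sub ?_ (HasAvg.succLife ho)).add (HasAvg.succLife hn)).add (hb l)
    by_cases h : (l : ℕ) + 1 < L
    · simp only [succLife, h, dif_pos]
      have hlt : l < ⟨(l : ℕ) + 1, h⟩ := Fin.lt_def.2 (Nat.lt_succ_self _)
      exact ih ⟨(l : ℕ) + 1, h⟩ (by simp only; omega) (fun m hm => ho m (hlt.trans hm))
        fun m hm => hn m (hlt.trans hm)
    · simp only [succLife, h, dif_neg, not_false_eq_true]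
      exact hasAvg_const 0

theorem measurable_succLife {Ω : Type*} {m : MeasurableSpace Ω} {f : Ω → Fin L → ℝ}
    (hf : ∀ l, Measurable fun ω => f ω l) (l : Fin L) : Measurable fun ω => succLife (f ω) l := by
  unfold succLife
  split_ifs
  · exact hf _
  · exact measurable_const

theorem measurable_arrival {V : Type*} {Ω : Type*} {m : MeasurableSpace Ω} {a : Ω → V → Fin L → ℕ}
    (ha : Measurable a) (i : V) (l : Fin L) : Measurable fun ω => (a ω i l : ℝ) := by
  have h : Measurable fun ω => a ω i l :=
    (measurable_pi_apply l).comp ((measurable_pi_apply i).comp ha)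
  exact (measurable_of_countable fun n : ℕ => (n : ℝ)).comp h

end Lifetimes

/-! ### Bounds and measurability for the lifetime queues. -/

section Queues

variable {V : Type*} [Fintype V] {L : ℕ}

theorem flow_le_outflow {x : Flow V L} (hx : ∀ i j l, 0 ≤ x i j l) (i j : V) (l : Fin L) :
    x i j l ≤ outflow x i l :=
  Finset.single_le_sum (f := fun j => x i j l) (fun j _ => hx i j l) (Finset.mem_univ j)

theorem outflow_nonneg {x : Flow V L} (hx : ∀ i j l, 0 ≤ x i j l) (i : V) (l : Fin L) :
    0 ≤ outflow x i l := Finset.sum_nonneg fun j _ => hx i j l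

theorem inflow_nonneg {x : Flow V L} (hx : ∀ i j l, 0 ≤ x i j l) (i : V) (l : Fin L) :
    0 ≤ inflow x i l := Finset.sum_nonneg fun j _ => hx j i l

theorem measurable_outflow {Ω : Type*} {m : MeasurableSpace Ω} {x : Ω → Flow V L}
    (hx : ∀ i j l, Measurable fun ω => x ω i j l) (i : V) (l : Fin L) :
    Measurable fun ω => outflow (x ω) i l := Finset.measurable_fun_sum _ fun j _ => hx i j l

theorem measurable_inflow {Ω : Type*} {m : MeasurableSpace Ω} {x : Ω → Flow V L}
    (hx : ∀ i j l, Measurable fun ω => x ω i j l) (i : V) (l : Fin L) :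
    Measurable fun ω => inflow (x ω) i l := Finset.measurable_fun_sum _ fun j _ => hx j i l

/-- Conservation is thus the condition that, where `supply` is positive, the quotients of flow by
`supply` sum to at most one. -/
theorem conserves_iff_outflow_le_supply {x : Flow V L} {lam : V → Fin L → ℝ} {i : V}
    {l : Fin L} : Conserves x lam i l ↔ outflow x i l ≤ supply x lam i l := by
  unfold Conserves supply
  rw [geq_eq_add_gtr (outflow x i), le_sub_iff_add_le]

/-- A bound for the lifetime queues. -/
noncomputable def queueBound (V : Type*) [Fintype V] (L Amax : ℕ) : ℝ :=
  Amax * ((Fintype.card V : ℝ) + 2) ^ L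

variable [DecidableEq V]

theorem queue_dest (G : Network V) (a : ℕ → V → Fin L → ℕ) (x : ℕ → Flow V L) (t : ℕ)
    (l : Fin L) : queue G a x t G.d l = 0 := by
  cases t <;> simp [queue]

theorem queue_succ (G : Network V) (a : ℕ → V → Fin L → ℕ) (x : ℕ → Flow V L) (t : ℕ) {i : V}
    (hi : i ≠ G.d) (l : Fin L) : queue G a x (t + 1) i l
      = succLife (queue G a x t i) l - succLife (outflow (x t) i) l
        + succLife (inflow (x t) i) l + a t i l := by
  simp [queue, hi]

/-- A packet changes its lifetime in every slot, so nothing accumulates: a queue is fed only by the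
queues of the next larger lifetime and by new arrivals. -/
theorem queue_le_queueBound (G : Network V) {a : ℕ → V → Fin L → ℕ} {x : ℕ → Flow V L} {Amax : ℕ}
    (ha : ∀ t i l, a t i l ≤ Amax) (hx : ∀ t i j l, 0 ≤ x t i j l)
    (hout : ∀ t i l, outflow (x t) i l ≤ queue G a x t i l) (t : ℕ) (i : V) (l : Fin L) :
    queue G a x t i l ≤ queueBound V L Amax := by
  set c : ℝ := (Fintype.card V : ℝ) + 2 with hc
  have hc1 : 1 ≤ c := by rw [hc]; have : (0 : ℝ) ≤ Fintype.card V := Nat.cast_nonneg _; linarith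
  -- The exponent counts the lifetimes above `l`. Passing to the next smaller lifetime costs a
  -- factor `c`: one for each possible sender, one for the node's own queue, one for the arrivals.
  suffices H : ∀ t i (l : Fin L), queue G a x t i l ≤ Amax * c ^ (L - 1 - (l : ℕ)) by
    refine (H t i l).trans ?_
    unfold queueBound
    gcongr 1
    exact pow_le_pow_right₀ hc1 (by omega)
  intro t
  induction t with
  | zero => intro i l; simp only [queue]; positivity
  | succ t ih =>
    intro i l
    by_cases hi : i = G.d
    · rw [hi, queue_dest]; positivity
    rw [queue_succ G a x t hi]
    have hA : (a t i l : ℝ) ≤ Amax := by exact_mod_cast ha t i l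
    by_cases h : (l : ℕ) + 1 < L
    · simp only [succLife, h, dif_pos]
      set m : Fin L := ⟨(l : ℕ) + 1, h⟩ with hm
      have e : L - 1 - (l : ℕ) = (L - 1 - (m : ℕ)) + 1 := by simp only [hm]; omega
      rw [e, pow_succ]
      set y : ℝ := Amax * c ^ (L - 1 - (m : ℕ)) with hy
      have hAy : (Amax : ℝ) ≤ y := le_mul_of_one_le_right (Nat.cast_nonneg _) (one_le_pow₀ hc1)
      have hin : inflow (x t) i m ≤ Fintype.card V * y := by
        unfold inflow
        refine (Finset.sum_le_sum fun j _ =>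
          (flow_le_outflow (hx t) j i m).trans ((hout t j m).trans (ih j m))).trans ?_
        simp [hy]
      have hout0 := outflow_nonneg (hx t) i m
      have hq := ih i m
      have : (Amax : ℝ) * (c ^ (L - 1 - (m : ℕ)) * c) = y * c := by rw [hy]; ring
      rw [this, hc]
      linarith
    · simp only [succLife, h, dif_neg, not_false_eq_true]
      have : (Amax : ℝ) ≤ Amax * c ^ (L - 1 - (l : ℕ)) :=
        le_mul_of_one_le_right (Nat.cast_nonneg _) (one_le_pow₀ hc1)
      linarith

theorem measurable_queue {Ω : Type*} {m : MeasurableSpace Ω} (G : Network V)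
    {a : ℕ → Ω → V → Fin L → ℕ} {x : ℕ → Ω → Flow V L} (t : ℕ)
    (ha : ∀ s < t, Measurable (a s))
    (hx : ∀ s < t, ∀ i j l, Measurable fun ω => x s ω i j l) (i : V) (l : Fin L) :
    Measurable fun ω => queue G (fun s => a s ω) (fun s => x s ω) t i l := by
  induction t generalizing i l with
  | zero => exact measurable_const
  | succ t ih =>
    by_cases hi : i = G.d
    · subst hi
      simp only [queue_dest]
      exact measurable_const
    · simp only [queue_succ G _ _ _ hi]
      have hxt := hx t (Nat.lt_succ_self t)
      exact (((measurable_succLife (fun l => ih (fun s hs => ha s (hs.trans (Nat.lt_succ_self t)))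
        (fun s hs => hx s (hs.trans (Nat.lt_succ_self t))) i l) l).sub
        (measurable_succLife (fun l => measurable_outflow hxt i l) l)).add
        (measurable_succLife (fun l => measurable_inflow hxt i l) l)).add
        (measurable_arrival (ha t (Nat.lt_succ_self t)) i l)

end Queues

/-! ### Feasible flow assignments are static flows. -/

section StaticFlows

variable {V : Type*} {L : ℕ} {Ω : Type*} {mΩ : MeasurableSpace Ω} {P : Measure Ω}
  {G : Network V} {lam : V → Fin L → ℝ} {gam : ℝ} {Amax : ℕ} {a : ℕ → Ω → V → Fin L → ℕ}

theorem IsArrivalProcess.integral_eq (ha : IsArrivalProcess P G lam Amax a) (t : ℕ) (i : V)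
    (l : Fin L) : ∫ ω, (a t ω i l : ℝ) ∂P = lam i l := by
  have hm : Measurable fun b : V → Fin L → ℕ => (b i l : ℝ) := measurable_arrival measurable_id i l
  exact ((ha.ident t).comp hm).integral_eq.trans (ha.mean i l)

theorem IsArrivalProcess.integrable [IsProbabilityMeasure P]
    (ha : IsArrivalProcess P G lam Amax a) (t : ℕ) (i : V)
    (l : Fin L) : Integrable (fun ω => (a t ω i l : ℝ)) P := by
  refine Integrable.of_bound (measurable_arrival (ha.meas t) i l).aestronglyMeasurable Amax ?_
  filter_upwards [ha.bound t] with ω hω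
  rw [Real.norm_eq_abs, Nat.abs_cast]
  exact_mod_cast hω i l

variable [Fintype V]

theorem IsArrivalProcess.hasAvg [IsProbabilityMeasure P]
    (ha : IsArrivalProcess P G lam Amax a) :
    ∀ᵐ ω ∂P, ∀ i l, HasAvg (fun t => (a t ω i l : ℝ)) (lam i l) := by
  refine ae_all_iff.2 fun i => ae_all_iff.2 fun l => ?_
  have hm : Measurable fun b : V → Fin L → ℕ => (b i l : ℝ) := measurable_arrival measurable_id i l
  rw [← ha.integral_eq 0 i l]
  exact strong_law_ae_real (fun t ω => (a t ω i l : ℝ)) (ha.integrable 0 i l)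
    (fun s t hst => (ha.indep.indepFun hst).comp hm hm) fun t => (ha.ident t).comp hm

theorem integral_succLife {f : Ω → Fin L → ℝ} (l : Fin L) :
    ∫ ω, succLife (f ω) l ∂P = succLife (fun m => ∫ ω, f ω m ∂P) l := by
  unfold succLife
  split_ifs <;> simp

theorem integrable_succLife {f : Ω → Fin L → ℝ} (hf : ∀ l, Integrable (fun ω => f ω l) P)
    (l : Fin L) : Integrable (fun ω => succLife (f ω) l) P := by
  unfold succLife
  split_ifs
  · exact hf _
  · exact integrable_zero _ _ _

variable [DecidableEq V]

/-- The link flows that satisfy flow conservation and reliability on average. -/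
structure IsStaticFlow (G : Network V) (lam : V → Fin L → ℝ) (gam : ℝ) (x : Flow V L) :
    Prop where
  virtual : IsVirtualFlow G x
  conserves : ∀ i, i ≠ G.d → ∀ l, Conserves x lam i l
  reliable : gam * ∑ i, ∑ l, lam i l ≤ ∑ l, inflow x G.d l

/-- The flow assignment of feasible decisions is a static flow. -/
theorem IsFeasible.isStaticFlow [IsProbabilityMeasure P] {x : ℕ → Ω → Flow V L} {xbar : Flow V L}
    (ha : IsArrivalProcess P G lam Amax a) (hx : IsFeasible P G lam gam a x xbar) :
    IsStaticFlow G lam gam xbar := by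
  have hall : ∀ᵐ ω ∂P, (∀ t i j l, 0 ≤ x t ω i j l) ∧ ∀ t i l,
      outflow (x t ω) i l ≤ queue G (fun s => a s ω) (fun s => x s ω) t i l ∧
      queue G (fun s => a s ω) (fun s => x s ω) t i l ≤ queueBound V L Amax := by
    filter_upwards [ae_all_iff.2 hx.nonneg, ae_all_iff.2 hx.availability, ae_all_iff.2 ha.bound]
      with ω h1 h2 h3
    exact ⟨h1, fun t i l => ⟨h2 t i l, queue_le_queueBound G h3 h1 h2 t i l⟩⟩
  have hqm : ∀ t i l, Measurable fun ω => queue G (fun s => a s ω) (fun s => x s ω) t i l :=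
    fun t => measurable_queue G t (fun s _ => ha.meas s) fun s _ => hx.meas s
  have hqi : ∀ t i l, Integrable
      (fun ω => queue G (fun s => a s ω) (fun s => x s ω) t i l) P := fun t i l => by
    refine Integrable.of_bound (hqm t i l).aestronglyMeasurable (queueBound V L Amax) ?_
    filter_upwards [hall] with ω hω
    obtain ⟨h1, h2⟩ := hω.2 t i l
    rw [Real.norm_eq_abs, abs_of_nonneg ((outflow_nonneg (hω.1 t) i l).trans h1)]
    exact h2
  have hxi : ∀ t i j l, Integrable (fun ω => x t ω i j l) P := fun t i j l => by
    refine Integrable.of_bound (hx.meas t i j l).aestronglyMeasurable (queueBound V L Amax) ?_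
    filter_upwards [hall] with ω hω
    obtain ⟨h1, h2⟩ := hω.2 t i l
    rw [Real.norm_eq_abs, abs_of_nonneg (hω.1 t i j l)]
    exact (flow_le_outflow (hω.1 t) i j l).trans (h1.trans h2)
  have houti : ∀ t i l, Integrable (fun ω => outflow (x t ω) i l) P := fun t i l =>
    integrable_finsetSum _ fun j _ => hxi t i j l
  have hini : ∀ t i l, Integrable (fun ω => inflow (x t ω) i l) P := fun t i l =>
    integrable_finsetSum _ fun j _ => hxi t j i l
  have hout : ∀ i l, HasAvg (fun t => ∫ ω, outflow (x t ω) i l ∂P) (outflow xbar i l) :=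
    fun i l => by
      simp only [outflow, integral_finsetSum _ fun j _ => hxi _ i j l]
      exact HasAvg.sum _ fun j _ => hx.assignment i j l
  have hin : ∀ i l, HasAvg (fun t => ∫ ω, inflow (x t ω) i l ∂P) (inflow xbar i l) :=
    fun i l => by
      simp only [inflow, integral_finsetSum _ fun j _ => hxi _ j i l]
      exact HasAvg.sum _ fun j _ => hx.assignment j i l
  have hnonneg : ∀ i j l, 0 ≤ xbar i j l := fun i j l =>
    (hasAvg_const 0).le (hx.assignment i j l) fun t =>
      integral_nonneg_of_ae ((hx.nonneg t).mono fun ω hω => hω i j l)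
  have hlink : ∀ i j l, (i, j) ∉ G.E → xbar i j l = 0 := fun i j l hij => by
    refine (hx.assignment i j l).unique ?_
    have : ∀ t, ∫ ω, x t ω i j l ∂P = 0 := fun t =>
      integral_eq_zero_of_ae ((hx.link t).mono fun ω hω => hω i j l hij)
    simp only [this]
    exact hasAvg_const 0
  refine ⟨⟨hnonneg, hlink, fun j l => le_antisymm ?_ (hnonneg _ _ _), fun i j => ?_⟩,
    fun i hi l => conserves_iff_outflow_le_supply.2 ?_, hx.reliability⟩
  -- The destination's queue is always empty, so availability forbids any outflow there.
  · refine (flow_le_outflow hnonneg G.d j l).trans ((hout G.d l).le (hasAvg_const 0) fun t => ?_)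
    refine integral_nonpos_of_ae ?_
    filter_upwards [hx.availability t] with ω hω
    simpa [queue_dest] using hω G.d l
  · by_cases hij : (i, j) ∈ G.E
    · exact hx.capacity i j hij
    · simp [hlink i j _ hij, G.C_nonneg]
  -- The expected queues obey the same linear recursion with the expected flows, so their average is
  -- `supply`; availability is then averaged.
  · refine (hout i l).le (hasAvg_queue
      (q := fun t l => ∫ ω, queue G (fun s => a s ω) (fun s => x s ω) t i l ∂P)
      (o := fun t l => ∫ ω, outflow (x t ω) i l ∂P) (n := fun t l => ∫ ω, inflow (x t ω) i l ∂P)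
      (b := fun _ l => lam i l) (fun t l => ?_) (fun l => hasAvg_const _) l
      (fun m _ => hout i m) fun m _ => hin i m) fun t => ?_
    · simp only [queue_succ G _ _ _ hi]
      have i1 := integrable_succLife (hqi t i) l
      have i2 := integrable_succLife (houti t i) l
      have i3 := integrable_succLife (hini t i) l
      have i4 := i1.sub i2
      have i5 := i4.add i3
      simp only [Pi.sub_def, Pi.add_def] at i4 i5
      rw [integral_add i5 (ha.integrable t i l), integral_add i4 i3,
        integral_sub i1 i2, integral_succLife, integral_succLife, integral_succLife,
        ha.integral_eq]
    · exact integral_mono_ae (houti t i l) (hqi t i l) (hall.mono fun ω hω => (hω.2 t i l).1)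

end StaticFlows

/-! ### Drift-plus-penalty inequality along a sample path. -/

section Drift

variable {V : Type*} {L : ℕ}

theorem IsVirtualFlow.le_capacity {G : Network V} {y : Flow V L} (hy : IsVirtualFlow G y)
    (i j : V) (l : Fin L) : y i j l ≤ G.C i j :=
  (Finset.single_le_sum (f := fun l => y i j l) (fun l _ => hy.nonneg i j l)
    (Finset.mem_univ l)).trans (hy.capacity i j)

theorem cost_nonneg {G : Network V} {y : Flow V L} (hy : ∀ i j l, 0 ≤ y i j l) : 0 ≤ cost G y :=
  Finset.sum_nonneg fun _ _ => mul_nonneg (G.e_nonneg _ _) (Finset.sum_nonneg fun l _ => hy _ _ l)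

variable [Fintype V]

/-- The increment of the virtual queue of the destination, before it is truncated at zero. -/
def destDrift (G : Network V) (gam : ℝ) (b : V → Fin L → ℝ) (y : Flow V L) : ℝ :=
  gam * ∑ i, ∑ l, b i l - ∑ l, inflow y G.d l

/-- The increment of the virtual queues of the nodes, before it is truncated at zero. -/
def nodeDrift (b : V → Fin L → ℝ) (y : Flow V L) (i : V) (l : Fin L) : ℝ :=
  geq (outflow y i) l - gtr (inflow y i) l - geq (b i) l

theorem destQueue_succ (G : Network V) (gam : ℝ) (a : ℕ → V → Fin L → ℕ) (ν : ℕ → Flow V L)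
    (t : ℕ) : destQueue G gam a ν (t + 1)
      = max (destQueue G gam a ν t + destDrift G gam (fun i l => (a t i l : ℝ)) (ν t)) 0 := by
  simp only [destQueue, destDrift, add_sub_assoc]

theorem nodeQueue_succ (a : ℕ → V → Fin L → ℕ) (ν : ℕ → Flow V L) (t : ℕ) (i : V) (l : Fin L) :
    nodeQueue a ν (t + 1) i l
      = max (nodeQueue a ν t i l + nodeDrift (fun i l => (a t i l : ℝ)) (ν t) i l) 0 := by
  simp only [nodeQueue, nodeDrift]
  congr 1
  ring

theorem destQueue_nonneg (G : Network V) (gam : ℝ) (a : ℕ → V → Fin L → ℕ) (ν : ℕ → Flow V L)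
    (t : ℕ) : 0 ≤ destQueue G gam a ν t := by
  cases t
  · exact le_rfl
  · exact le_max_right _ _

theorem nodeQueue_nonneg (a : ℕ → V → Fin L → ℕ) (ν : ℕ → Flow V L) (t : ℕ) (i : V)
    (l : Fin L) : 0 ≤ nodeQueue a ν t i l := by
  cases t
  · exact le_rfl
  · exact le_max_right _ _

/-- Truncation at zero can only enlarge the queue, so a small queue forces a small cumulative drift.
-/
theorem sum_destDrift_le_destQueue (G : Network V) (gam : ℝ) (a : ℕ → V → Fin L → ℕ)
    (ν : ℕ → Flow V L) (T : ℕ) :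
    ∑ t ∈ Finset.range T, destDrift G gam (fun i l => (a t i l : ℝ)) (ν t)
      ≤ destQueue G gam a ν T := by
  induction T with
  | zero => simp [destQueue]
  | succ T ih =>
    rw [Finset.sum_range_succ, destQueue_succ]
    exact le_max_of_le_left (add_le_add_left ih _)

theorem sum_nodeDrift_le_nodeQueue (a : ℕ → V → Fin L → ℕ)
    (ν : ℕ → Flow V L) (i : V) (l : Fin L) (T : ℕ) :
    ∑ t ∈ Finset.range T, nodeDrift (fun i l => (a t i l : ℝ)) (ν t) i l
      ≤ nodeQueue a ν T i l := by
  induction T with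
  | zero => simp [nodeQueue]
  | succ T ih =>
    rw [Finset.sum_range_succ, nodeQueue_succ]
    exact le_max_of_le_left (add_le_add_left ih _)

theorem IsVirtualFlow.sum_inflow_le {G : Network V} {y : Flow V L} (hy : IsVirtualFlow G y)
    (i : V) : ∑ l, inflow y i l ≤ ∑ j, ∑ k, G.C j k := by
  simp only [inflow]
  rw [Finset.sum_comm]
  refine Finset.sum_le_sum fun j _ => (hy.capacity j i).trans ?_
  exact Finset.single_le_sum (f := fun k => G.C j k) (fun k _ => G.C_nonneg j k)
    (Finset.mem_univ i)

theorem IsVirtualFlow.sum_outflow_le {G : Network V} {y : Flow V L} (hy : IsVirtualFlow G y)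
    (i : V) : ∑ l, outflow y i l ≤ ∑ j, ∑ k, G.C j k := by
  simp only [outflow]
  rw [Finset.sum_comm]
  refine (Finset.sum_le_sum fun j _ => hy.capacity i j).trans ?_
  exact Finset.single_le_sum (f := fun j => ∑ k, G.C j k)
    (fun j _ => Finset.sum_nonneg fun k _ => G.C_nonneg j k) (Finset.mem_univ i)

/-- A bound for the increments of the virtual queues. -/
noncomputable def driftBound (G : Network V) (L Amax : ℕ) : ℝ :=
  ∑ j, ∑ k, G.C j k + ∑ _i : V, ∑ _l : Fin L, (Amax : ℝ)

theorem abs_destDrift_le {G : Network V} {gam : ℝ} {b : V → Fin L → ℕ} {y : Flow V L} {Amax : ℕ}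
    (h0 : 0 ≤ gam) (h1 : gam ≤ 1) (hb : ∀ i l, b i l ≤ Amax) (hy : IsVirtualFlow G y) :
    |destDrift G gam (fun i l => (b i l : ℝ)) y| ≤ driftBound G L Amax := by
  have hb1 : (0 : ℝ) ≤ ∑ i, ∑ l, (b i l : ℝ) := by positivity
  have hb2 : ∑ i, ∑ l, (b i l : ℝ) ≤ ∑ _i : V, ∑ _l : Fin L, (Amax : ℝ) :=
    Finset.sum_le_sum fun i _ => Finset.sum_le_sum fun l _ => by exact_mod_cast hb i l
  have hy1 : 0 ≤ ∑ l, inflow y G.d l := Finset.sum_nonneg fun l _ => inflow_nonneg hy.nonneg _ l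
  have hy2 := hy.sum_inflow_le G.d
  have h2 : 0 ≤ gam * ∑ i, ∑ l, (b i l : ℝ) := mul_nonneg h0 hb1
  have h3 : gam * ∑ i, ∑ l, (b i l : ℝ) ≤ ∑ i, ∑ l, (b i l : ℝ) := mul_le_of_le_one_left hb1 h1
  unfold destDrift driftBound
  rw [abs_le]
  constructor <;> linarith

theorem abs_nodeDrift_le {G : Network V} {b : V → Fin L → ℕ} {y : Flow V L} {Amax : ℕ}
    (hb : ∀ i l, b i l ≤ Amax) (hy : IsVirtualFlow G y) (i : V) (l : Fin L) :
    |nodeDrift (fun i l => (b i l : ℝ)) y i l| ≤ driftBound G L Amax := by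
  have hb0 : ∀ l, (0 : ℝ) ≤ b i l := fun l => Nat.cast_nonneg _
  have hb1 := geq_nonneg hb0 l
  have hb2 := geq_le_sum hb0 l
  have hb3 : ∑ l, (b i l : ℝ) ≤ ∑ _l : Fin L, (Amax : ℝ) :=
    Finset.sum_le_sum fun l _ => by exact_mod_cast hb i l
  have hb4 : ∑ _l : Fin L, (Amax : ℝ) ≤ ∑ _i : V, ∑ _l : Fin L, (Amax : ℝ) :=
    Finset.single_le_sum (f := fun _ : V => ∑ _l : Fin L, (Amax : ℝ))
      (fun _ _ => by positivity) (Finset.mem_univ i)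
  have ho1 := geq_nonneg (outflow_nonneg hy.nonneg i) l
  have ho2 := (geq_le_sum (outflow_nonneg hy.nonneg i) l).trans (hy.sum_outflow_le i)
  have hi1 := gtr_nonneg (inflow_nonneg hy.nonneg i) l
  have hi2 := (gtr_le_sum (inflow_nonneg hy.nonneg i) l).trans (hy.sum_inflow_le i)
  unfold nodeDrift driftBound
  rw [abs_le]
  constructor <;> linarith

/-- This crude linear bound serves only for integrability; the growth estimate that matters comes
from the Lyapunov function. -/
theorem destQueue_le {G : Network V} {gam : ℝ} {a : ℕ → V → Fin L → ℕ} {ν : ℕ → Flow V L}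
    {Amax : ℕ} (h0 : 0 ≤ gam) (h1 : gam ≤ 1) (ha : ∀ t i l, a t i l ≤ Amax)
    (hν : ∀ t, IsVirtualFlow G (ν t)) (t : ℕ) :
    destQueue G gam a ν t ≤ t * driftBound G L Amax := by
  induction t with
  | zero => simp [destQueue]
  | succ t ih =>
    have hd := abs_destDrift_le h0 h1 (ha t) (hν t)
    have hd0 := (abs_nonneg _).trans hd
    have := (le_abs_self _).trans hd
    rw [destQueue_succ]
    push_cast
    exact max_le (by linarith) (by positivity)

theorem nodeQueue_le {G : Network V} {a : ℕ → V → Fin L → ℕ} {ν : ℕ → Flow V L}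
    {Amax : ℕ} (ha : ∀ t i l, a t i l ≤ Amax)
    (hν : ∀ t, IsVirtualFlow G (ν t)) (t : ℕ) (i : V) (l : Fin L) :
    nodeQueue a ν t i l ≤ t * driftBound G L Amax := by
  induction t with
  | zero => simp [nodeQueue]
  | succ t ih =>
    have hd := abs_nodeDrift_le (ha t) (hν t) i l
    have hd0 := (abs_nonneg _).trans hd
    have := (le_abs_self _).trans hd
    rw [nodeQueue_succ]
    push_cast
    exact max_le (by linarith) (by positivity)

theorem IsVirtualFlow.cost_eq {G : Network V} {y : Flow V L} (hy : IsVirtualFlow G y) :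
    cost G y = ∑ i, ∑ j, ∑ l, G.e i j * y i j l := by
  unfold cost
  rw [← Fintype.sum_prod_type' (f := fun i j => ∑ l, G.e i j * y i j l)]
  simp only [Finset.mul_sum]
  refine Finset.sum_subset (Finset.subset_univ _) fun p _ hp => ?_
  exact Finset.sum_eq_zero fun l _ => by rw [hy.link p.1 p.2 l hp, mul_zero]

variable [DecidableEq V]

/-- The Lyapunov function of the virtual queues. -/
def lyapunov (G : Network V) (Ud : ℝ) (U : V → Fin L → ℝ) : ℝ :=
  Ud ^ 2 + ∑ i ∈ Finset.univ.erase G.d, ∑ l, U i l ^ 2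

/-- The first-order part of the drift of the Lyapunov function. -/
def driftPairing (G : Network V) (gam Ud : ℝ) (U b : V → Fin L → ℝ) (y : Flow V L) : ℝ :=
  Ud * destDrift G gam b y + ∑ i ∈ Finset.univ.erase G.d, ∑ l, U i l * nodeDrift b y i l

/-- The sensitivity of the drift to the arrivals. -/
def arrivalCoeff (G : Network V) (gam Ud : ℝ) (U : V → Fin L → ℝ) (i : V) (l : Fin L) : ℝ :=
  gam * Ud - if i = G.d then 0 else leq (U i) l

theorem sum_ite_dest (G : Network V) (A B : V → ℝ) :
    ∑ i, (if i = G.d then A i else B i) = A G.d + ∑ i ∈ Finset.univ.erase G.d, B i := by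
  rw [← Finset.add_sum_erase _ _ (Finset.mem_univ G.d), if_pos rfl]
  congr 1
  exact Finset.sum_congr rfl fun i hi => if_neg (Finset.ne_of_mem_erase hi)

/-- This identity explains the form of the weights: for given queues and arrivals, the left side is
smallest exactly when the weighted sum of the flow is largest. -/
theorem driftPairing_eq (G : Network V) (W gam Ud : ℝ) (U b : V → Fin L → ℝ) {y : Flow V L}
    (hy : IsVirtualFlow G y) :
    W * cost G y + driftPairing G gam Ud U b y
      = ∑ i, ∑ l, arrivalCoeff G gam Ud U i l * b i l
        - ∑ i, ∑ j, ∑ l, weight G W Ud U i j l * y i j l := by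
  have hout : ∑ i ∈ Finset.univ.erase G.d, ∑ l, U i l * geq (outflow y i) l
      = ∑ i, ∑ j, ∑ l, leq (U i) l * y i j l := by
    -- The destination sends nothing, so its term can be added for free.
    rw [← Finset.add_sum_erase _ _ (Finset.mem_univ G.d)]
    simp only [hy.dest, mul_zero, Finset.sum_const_zero, zero_add]
    refine Finset.sum_congr rfl fun i _ => ?_
    rw [sum_mul_geq, Finset.sum_comm]
    refine Finset.sum_congr rfl fun l _ => ?_
    rw [outflow, mul_comm, Finset.mul_sum]
  have hin : Ud * ∑ l, inflow y G.d l
      + ∑ j ∈ Finset.univ.erase G.d, ∑ l, U j l * gtr (inflow y j) l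
      = ∑ i, ∑ j, ∑ l, (if j = G.d then Ud else lss (U j) l) * y i j l := by
    conv_rhs => rw [Finset.sum_comm]
    have h1 : ∀ j, ∑ i, ∑ l, (if j = G.d then Ud else lss (U j) l) * y i j l
        = if j = G.d then Ud * ∑ l, inflow y j l else ∑ l, U j l * gtr (inflow y j) l := by
      intro j
      rw [Finset.sum_comm]
      split_ifs
      · simp only [inflow, Finset.mul_sum]
      · rw [sum_mul_gtr]
        refine Finset.sum_congr rfl fun l _ => ?_
        rw [inflow, mul_comm, Finset.mul_sum]
    simp only [h1]
    rw [sum_ite_dest]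
  have hb : ∑ i, ∑ l, arrivalCoeff G gam Ud U i l * b i l
      = Ud * (gam * ∑ i, ∑ l, b i l) - ∑ i ∈ Finset.univ.erase G.d, ∑ l, U i l * geq (b i) l := by
    have h1 : ∀ i, ∑ l, arrivalCoeff G gam Ud U i l * b i l = Ud * (gam * ∑ l, b i l)
        - if i = G.d then 0 else ∑ l, U i l * geq (b i) l := by
      intro i
      have h2 : Ud * (gam * ∑ l, b i l) = ∑ l, gam * Ud * b i l := by
        rw [← Finset.mul_sum]
        ring
      rw [h2]
      unfold arrivalCoeff
      split_ifs
      · simp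
      · rw [sum_mul_geq, ← Finset.sum_sub_distrib]
        exact Finset.sum_congr rfl fun l _ => by ring
    simp only [h1]
    rw [Finset.sum_sub_distrib, sum_ite_dest, zero_add, ← Finset.mul_sum, ← Finset.mul_sum]
  have hw : ∑ i, ∑ j, ∑ l, weight G W Ud U i j l * y i j l
      = ∑ i, ∑ j, ∑ l, (if j = G.d then Ud else lss (U j) l) * y i j l
        - ∑ i, ∑ j, ∑ l, leq (U i) l * y i j l - W * cost G y := by
    rw [hy.cost_eq]
    simp only [Finset.mul_sum, ← Finset.sum_sub_distrib]
    refine Finset.sum_congr rfl fun i _ => Finset.sum_congr rfl fun j _ =>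
      Finset.sum_congr rfl fun l _ => ?_
    unfold weight
    ring
  rw [hw, hb, ← hout, ← hin]
  unfold driftPairing destDrift nodeDrift
  simp only [mul_sub, Finset.sum_sub_distrib]
  ring

/-- The identity `driftPairing_eq` is used for `y` with the true arrivals and for `x` with the mean
rates. Max-weight compares the flow terms, and the pairing of `x` is nonpositive because `x` is
static. Only the deviation of the arrivals from their mean is left. -/
theorem driftPairing_le_of_isMaxWeight {G : Network V} {W gam Ud : ℝ} {U b lam : V → Fin L → ℝ}
    {x y : Flow V L} (hUd : 0 ≤ Ud) (hU : ∀ i l, 0 ≤ U i l) (hx : IsStaticFlow G lam gam x)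
    (hy : IsMaxWeight G (weight G W Ud U) y) :
    W * cost G y + driftPairing G gam Ud U b y
      ≤ W * cost G x + ∑ i, ∑ l, arrivalCoeff G gam Ud U i l * (b i l - lam i l) := by
  have h1 := driftPairing_eq G W gam Ud U b hy.flow
  have h2 := driftPairing_eq G W gam Ud U lam hx.virtual
  have h3 := hy.maximal x hx.virtual
  have h4 : driftPairing G gam Ud U lam x ≤ 0 := by
    unfold driftPairing
    refine add_nonpos (mul_nonpos_of_nonneg_of_nonpos hUd ?_) (Finset.sum_nonpos fun i hi =>
      Finset.sum_nonpos fun l _ => mul_nonpos_of_nonneg_of_nonpos (hU i l) ?_)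
    · exact sub_nonpos.2 hx.reliable
    · have := hx.conserves i (Finset.ne_of_mem_erase hi) l
      unfold Conserves at this
      unfold nodeDrift
      linarith
  simp only [mul_sub, Finset.sum_sub_distrib]
  linarith

theorem max_add_zero_sq_le {u δ M : ℝ} (hδ : |δ| ≤ M) :
    max (u + δ) 0 ^ 2 ≤ u ^ 2 + 2 * (u * δ) + M ^ 2 := by
  have h1 : δ ^ 2 ≤ M ^ 2 := sq_le_sq' (neg_le_of_abs_le hδ) (le_of_abs_le hδ)
  have h2 : max (u + δ) 0 ^ 2 ≤ (u + δ) ^ 2 := by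
    rcases le_total 0 (u + δ) with h | h
    · rw [max_eq_left h]
    · rw [max_eq_right h]
      simpa using sq_nonneg (u + δ)
  nlinarith

/-- The second-order part of the drift of the Lyapunov function. -/
noncomputable def lyapunovBound (G : Network V) (L Amax : ℕ) : ℝ :=
  driftBound G L Amax ^ 2
    + ∑ _i ∈ Finset.univ.erase G.d, ∑ _l : Fin L, driftBound G L Amax ^ 2

theorem lyapunov_succ_le {G : Network V} {gam : ℝ} {a : ℕ → V → Fin L → ℕ} {ν : ℕ → Flow V L}
    {Amax : ℕ} (h0 : 0 ≤ gam) (h1 : gam ≤ 1) (ha : ∀ t i l, a t i l ≤ Amax)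
    (hν : ∀ t, IsVirtualFlow G (ν t)) (t : ℕ) :
    lyapunov G (destQueue G gam a ν (t + 1)) (nodeQueue a ν (t + 1))
      ≤ lyapunov G (destQueue G gam a ν t) (nodeQueue a ν t)
        + 2 * driftPairing G gam (destQueue G gam a ν t) (nodeQueue a ν t)
          (fun i l => (a t i l : ℝ)) (ν t) + lyapunovBound G L Amax := by
  unfold lyapunov driftPairing lyapunovBound
  have hd := max_add_zero_sq_le (u := destQueue G gam a ν t) (abs_destDrift_le h0 h1 (ha t) (hν t))
  have hn := Finset.sum_le_sum fun i (_ : i ∈ Finset.univ.erase G.d) =>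
    Finset.sum_le_sum fun l (_ : l ∈ Finset.univ) =>
      max_add_zero_sq_le (u := nodeQueue a ν t i l) (abs_nodeDrift_le (ha t) (hν t) i l)
  simp only [Finset.sum_add_distrib, ← Finset.mul_sum] at hn
  simp only [destQueue_succ, nodeQueue_succ]
  linarith

end Drift

/-! ### Expected drift, cost bound and limit of the virtual flow. -/

section VirtualQueues

variable {V : Type*} {L : ℕ} {Ω : Type*}

theorem isVirtualFlow_of_hasAvg {G : Network V} {ν : ℕ → Flow V L} {νbar : Flow V L}
    (hν : ∀ t, IsVirtualFlow G (ν t))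
    (h : ∀ i j l, HasAvg (fun t => ν t i j l) (νbar i j l)) : IsVirtualFlow G νbar where
  nonneg i j l := (hasAvg_const 0).le (h i j l) fun t => (hν t).nonneg i j l
  link i j l hij := by
    have h1 := h i j l
    simp only [(hν _).link i j l hij] at h1
    exact h1.unique (hasAvg_const 0)
  dest j l := by
    have h1 := h G.d j l
    simp only [(hν _).dest j l] at h1
    exact h1.unique (hasAvg_const 0)
  capacity i j := (HasAvg.sum _ fun l _ => h i j l).le (hasAvg_const _) fun t => (hν t).capacity i j

theorem hasAvg_cost {G : Network V} {x : ℕ → Flow V L} {xbar : Flow V L}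
    (h : ∀ i j l, HasAvg (fun t => x t i j l) (xbar i j l)) :
    HasAvg (fun t => cost G (x t)) (cost G xbar) :=
  HasAvg.sum _ fun p _ => (HasAvg.sum _ fun l _ => h p.1 p.2 l).const_mul _

variable [Fintype V]

theorem measurable_destQueue {m : MeasurableSpace Ω} (G : Network V) (gam : ℝ)
    {a : ℕ → Ω → V → Fin L → ℕ} {ν : ℕ → Ω → Flow V L} (t : ℕ)
    (ha : ∀ s < t, Measurable (a s))
    (hν : ∀ s < t, ∀ i j l, Measurable fun ω => ν s ω i j l) :
    Measurable fun ω => destQueue G gam (fun s => a s ω) (fun s => ν s ω) t := by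
  induction t with
  | zero => exact measurable_const
  | succ t ih =>
    have hlt := Nat.lt_succ_self t
    simp only [destQueue]
    refine (((ih (fun s hs => ha s (hs.trans hlt)) fun s hs => hν s (hs.trans hlt)).add
      (Measurable.const_mul ?_ gam)).sub ?_).max measurable_const
    · exact Finset.measurable_fun_sum _ fun i _ => Finset.measurable_fun_sum _ fun l _ =>
        measurable_arrival (ha t hlt) i l
    · exact Finset.measurable_fun_sum _ fun l _ => measurable_inflow (hν t hlt) _ l

theorem measurable_nodeDrift {m : MeasurableSpace Ω} {b : Ω → V → Fin L → ℕ}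
    {y : Ω → Flow V L} (hb : Measurable b) (hy : ∀ i j l, Measurable fun ω => y ω i j l) (i : V)
    (l : Fin L) : Measurable fun ω => nodeDrift (fun i l => (b ω i l : ℝ)) (y ω) i l := by
  unfold nodeDrift
  exact ((Finset.measurable_fun_sum _ fun l _ => measurable_outflow hy i l).sub
    (Finset.measurable_fun_sum _ fun l _ => measurable_inflow hy i l)).sub
    (Finset.measurable_fun_sum _ fun l _ => measurable_arrival hb i l)

theorem measurable_destDrift {m : MeasurableSpace Ω} (G : Network V) (gam : ℝ)
    {b : Ω → V → Fin L → ℕ} {y : Ω → Flow V L} (hb : Measurable b)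
    (hy : ∀ i j l, Measurable fun ω => y ω i j l) :
    Measurable fun ω => destDrift G gam (fun i l => (b ω i l : ℝ)) (y ω) := by
  unfold destDrift
  exact (Measurable.const_mul (Finset.measurable_fun_sum _ fun i _ =>
    Finset.measurable_fun_sum _ fun l _ => measurable_arrival hb i l) gam).sub
    (Finset.measurable_fun_sum _ fun l _ => measurable_inflow hy _ l)

theorem measurable_nodeQueue {m : MeasurableSpace Ω}
    {a : ℕ → Ω → V → Fin L → ℕ} {ν : ℕ → Ω → Flow V L} (t : ℕ)
    (ha : ∀ s < t, Measurable (a s))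
    (hν : ∀ s < t, ∀ i j l, Measurable fun ω => ν s ω i j l) (i : V) (l : Fin L) :
    Measurable fun ω => nodeQueue (fun s => a s ω) (fun s => ν s ω) t i l := by
  induction t with
  | zero => exact measurable_const
  | succ t ih =>
    have hlt := Nat.lt_succ_self t
    simp only [nodeQueue_succ]
    exact ((ih (fun s hs => ha s (hs.trans hlt)) fun s hs => hν s (hs.trans hlt)).add
      (measurable_nodeDrift (ha t hlt) (hν t hlt) i l)).max measurable_const

variable [DecidableEq V] {mΩ : MeasurableSpace Ω} {P : Measure Ω}
  {ℱ : Filtration ℕ mΩ} {G : Network V} {W gam : ℝ} {a : ℕ → Ω → V → Fin L → ℕ}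
  {ν : ℕ → Ω → Flow V L} {α : ℕ → Ω → V → Fin L → V → ℝ}
  {D : ℕ → V → Fin L → ℕ → Ω → Option V} {μ : ℕ → Ω → Flow V L} {lam : V → Fin L → ℝ} {Amax : ℕ}
  {x : Flow V L} {νbar : Ω → Flow V L}

theorem IsFlowMatchingRun.isVirtualFlow (h : IsFlowMatchingRun P ℱ G W gam a ν α D μ) (t : ℕ)
    (ω : Ω) : IsVirtualFlow G (ν t ω) := (h.virtual_flow t ω).flow

theorem IsFlowMatchingRun.measurable_arrivals (h : IsFlowMatchingRun P ℱ G W gam a ν α D μ)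
    {s t : ℕ} (hst : s < t) : Measurable[ℱ t] (a s) :=
  (h.arrivals_observed s).mono (ℱ.mono hst) le_rfl

theorem IsFlowMatchingRun.measurable_virtual (h : IsFlowMatchingRun P ℱ G W gam a ν α D μ)
    {s t : ℕ} (hst : s ≤ t) (i j : V) (l : Fin L) : Measurable[ℱ t] fun ω => ν s ω i j l :=
  (h.virtual_adapted s i j l).mono (ℱ.mono hst) le_rfl

variable [IsProbabilityMeasure P]

/-- Independence is the case of `decision_law` in which no packet is specified. -/
theorem IsFlowMatchingRun.indep_arrivals (h : IsFlowMatchingRun P ℱ G W gam a ν α D μ) (t : ℕ) :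
    Indep (ℱ t) (MeasurableSpace.comap (a t) inferInstance) P := by
  rw [Indep_iff]
  rintro F _ hF ⟨B, _, rfl⟩
  have h1 := h.decision_law t F hF B ∅ fun _ => none
  simp only [Finset.notMem_empty, false_imp_iff, implies_true, Set.ofPred_true, Set.inter_univ,
    Finset.prod_empty, setIntegral_const, smul_eq_mul, mul_one] at h1
  rw [← ENNReal.toReal_eq_toReal_iff' (measure_ne_top _ _)
    (ENNReal.mul_ne_top (measure_ne_top _ _) (measure_ne_top _ _)), ENNReal.toReal_mul, mul_comm]
  exact h1

theorem IsFlowMatchingRun.setIntegral_arrival_sub (ha : IsArrivalProcess P G lam Amax a)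
    (h : IsFlowMatchingRun P ℱ G W gam a ν α D μ) (t : ℕ) (i : V) (l : Fin L) {F : Set Ω}
    (hF : MeasurableSet[ℱ t] F) : ∫ ω in F, ((a t ω i l : ℝ) - lam i l) ∂P = 0 := by
  have hm : Measurable fun b : V → Fin L → ℕ => (b i l : ℝ) := measurable_arrival measurable_id i l
  have h1 := (h.indep_arrivals t).setIntegral_eq_mul (ℱ.le t)
    (f := fun b : V → Fin L → ℕ => (b i l : ℝ)) (ha.meas t).aemeasurable hF
    hm.aestronglyMeasurable
  rw [integral_sub (ha.integrable t i l).integrableOn (integrable_const _), h1,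
    ha.integral_eq]
  simp

theorem IsFlowMatchingRun.memLp_destQueue (ha : IsArrivalProcess P G lam Amax a)
    (h : IsFlowMatchingRun P ℱ G W gam a ν α D μ) (h0 : 0 ≤ gam) (h1 : gam ≤ 1) (t : ℕ) :
    MemLp (fun ω => destQueue G gam (fun s => a s ω) (fun s => ν s ω) t) 2 P := by
  refine MemLp.of_bound (measurable_destQueue G gam t (fun s _ => ha.meas s) fun s _ i j l =>
    (h.virtual_adapted s i j l).mono (ℱ.le s) le_rfl).aestronglyMeasurable
    (t * driftBound G L Amax) ?_
  filter_upwards [ae_all_iff.2 ha.bound] with ω hω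
  rw [Real.norm_eq_abs, abs_of_nonneg (destQueue_nonneg _ _ _ _ _)]
  exact destQueue_le h0 h1 hω (fun s => h.isVirtualFlow s ω) t

theorem IsFlowMatchingRun.memLp_nodeQueue (ha : IsArrivalProcess P G lam Amax a)
    (h : IsFlowMatchingRun P ℱ G W gam a ν α D μ) (t : ℕ) (i : V) (l : Fin L) :
    MemLp (fun ω => nodeQueue (fun s => a s ω) (fun s => ν s ω) t i l) 2 P := by
  refine MemLp.of_bound (measurable_nodeQueue t (fun s _ => ha.meas s) (fun s _ i j l =>
    (h.virtual_adapted s i j l).mono (ℱ.le s) le_rfl) i l).aestronglyMeasurable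
    (t * driftBound G L Amax) ?_
  filter_upwards [ae_all_iff.2 ha.bound] with ω hω
  rw [Real.norm_eq_abs, abs_of_nonneg (nodeQueue_nonneg _ _ _ _ _)]
  exact nodeQueue_le hω (fun s => h.isVirtualFlow s ω) t i l

theorem IsFlowMatchingRun.integrable_lyapunov (ha : IsArrivalProcess P G lam Amax a)
    (h : IsFlowMatchingRun P ℱ G W gam a ν α D μ) (h0 : 0 ≤ gam) (h1 : gam ≤ 1) (t : ℕ) :
    Integrable (fun ω => lyapunov G (destQueue G gam (fun s => a s ω) (fun s => ν s ω) t)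
      (nodeQueue (fun s => a s ω) (fun s => ν s ω) t)) P :=
  (h.memLp_destQueue ha h0 h1 t).integrable_sq.add
    (integrable_finsetSum _ fun i _ => integrable_finsetSum _ fun l _ =>
      (h.memLp_nodeQueue ha t i l).integrable_sq)

/-- The coefficient depends only on the virtual queues, hence on the past, of which the arrivals in
slot `t` are independent. -/
theorem IsFlowMatchingRun.integral_arrivalCoeff (ha : IsArrivalProcess P G lam Amax a)
    (h : IsFlowMatchingRun P ℱ G W gam a ν α D μ) (h0 : 0 ≤ gam) (h1 : gam ≤ 1) (t : ℕ) (i : V)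
    (l : Fin L) :
    Integrable (fun ω => arrivalCoeff G gam (destQueue G gam (fun s => a s ω) (fun s => ν s ω) t)
      (nodeQueue (fun s => a s ω) (fun s => ν s ω) t) i l * ((a t ω i l : ℝ) - lam i l)) P ∧
    ∫ ω, arrivalCoeff G gam (destQueue G gam (fun s => a s ω) (fun s => ν s ω) t)
      (nodeQueue (fun s => a s ω) (fun s => ν s ω) t) i l * ((a t ω i l : ℝ) - lam i l) ∂P
      = 0 := by
  have hm : Measurable[ℱ t] fun ω => arrivalCoeff G gam
      (destQueue G gam (fun s => a s ω) (fun s => ν s ω) t)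
      (nodeQueue (fun s => a s ω) (fun s => ν s ω) t) i l := by
    unfold arrivalCoeff
    refine (Measurable.const_mul (measurable_destQueue G gam t
      (fun s hs => h.measurable_arrivals hs) fun s hs => h.measurable_virtual hs.le) gam).sub ?_
    split_ifs
    · exact measurable_const
    · exact Finset.measurable_fun_sum _ fun l _ => measurable_nodeQueue t
        (fun s hs => h.measurable_arrivals hs) (fun s hs => h.measurable_virtual hs.le) i l
  have hi : Integrable (fun ω => arrivalCoeff G gam
      (destQueue G gam (fun s => a s ω) (fun s => ν s ω) t)
      (nodeQueue (fun s => a s ω) (fun s => ν s ω) t) i l) P := by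
    unfold arrivalCoeff
    refine (((h.memLp_destQueue ha h0 h1 t).integrable one_le_two).const_mul gam).sub ?_
    split_ifs
    · exact integrable_zero _ _ _
    · exact integrable_finsetSum _ fun l _ =>
        (h.memLp_nodeQueue ha t i l).integrable one_le_two
  have hai : Integrable (fun ω => (a t ω i l : ℝ) - lam i l) P :=
    (ha.integrable t i l).sub (integrable_const _)
  have hprod : Integrable (fun ω => arrivalCoeff G gam
      (destQueue G gam (fun s => a s ω) (fun s => ν s ω) t)
      (nodeQueue (fun s => a s ω) (fun s => ν s ω) t) i l * ((a t ω i l : ℝ) - lam i l)) P := by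
    refine hi.mul_bdd hai.aestronglyMeasurable (c := Amax + |lam i l|) ?_
    filter_upwards [ha.bound t] with ω hω
    refine (norm_sub_le _ _).trans ?_
    rw [Real.norm_eq_abs, Real.norm_eq_abs, Nat.abs_cast]
    have : (a t ω i l : ℝ) ≤ Amax := by exact_mod_cast hω i l
    linarith
  exact ⟨hprod, integral_mul_eq_zero_of_setIntegral (ℱ.le t) hm hprod hai
    fun F hF => h.setIntegral_arrival_sub ha t i l hF⟩

theorem IsFlowMatchingRun.integrable_virtual (h : IsFlowMatchingRun P ℱ G W gam a ν α D μ)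
    (t : ℕ) (i j : V) (l : Fin L) : Integrable (fun ω => ν t ω i j l) P := by
  refine Integrable.of_bound ((h.virtual_adapted t i j l).mono (ℱ.le t)
    le_rfl).aestronglyMeasurable (G.C i j) (ae_of_all _ fun ω => ?_)
  rw [Real.norm_eq_abs, abs_of_nonneg ((h.isVirtualFlow t ω).nonneg i j l)]
  exact (h.isVirtualFlow t ω).le_capacity i j l

theorem IsFlowMatchingRun.integrable_cost (h : IsFlowMatchingRun P ℱ G W gam a ν α D μ)
    (t : ℕ) : Integrable (fun ω => cost G (ν t ω)) P :=
  integrable_finsetSum _ fun p _ => (integrable_finsetSum _ fun l _ =>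
    h.integrable_virtual t p.1 p.2 l).const_mul _

/-- The drift-plus-penalty inequality, summed over time. -/
theorem IsFlowMatchingRun.integral_lyapunov_le (ha : IsArrivalProcess P G lam Amax a)
    (h : IsFlowMatchingRun P ℱ G W gam a ν α D μ) (h0 : 0 ≤ gam) (h1 : gam ≤ 1)
    (hx : IsStaticFlow G lam gam x) (T : ℕ) :
    ∫ ω, lyapunov G (destQueue G gam (fun s => a s ω) (fun s => ν s ω) T)
        (nodeQueue (fun s => a s ω) (fun s => ν s ω) T) ∂P
      + 2 * W * ∑ t ∈ Finset.range T, ∫ ω, cost G (ν t ω) ∂P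
      ≤ (lyapunovBound G L Amax + 2 * W * cost G x) * T := by
  induction T with
  | zero => simp [lyapunov, destQueue, nodeQueue]
  | succ T ih =>
    have hl := h.integrable_lyapunov ha h0 h1
    have hcoeff := fun i l => h.integral_arrivalCoeff ha h0 h1 T i l
    have hsumi := integrable_finsetSum Finset.univ fun i _ =>
      integrable_finsetSum Finset.univ fun l _ => (hcoeff i l).1
    have hsum0 : ∫ ω, ∑ i, ∑ l, arrivalCoeff G gam
        (destQueue G gam (fun s => a s ω) (fun s => ν s ω) T)
        (nodeQueue (fun s => a s ω) (fun s => ν s ω) T) i l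
          * ((a T ω i l : ℝ) - lam i l) ∂P = 0 := by
      rw [integral_finsetSum _ fun i _ => integrable_finsetSum _ fun l _ => (hcoeff i l).1]
      refine Finset.sum_eq_zero fun i _ => ?_
      rw [integral_finsetSum _ fun l _ => (hcoeff i l).1]
      exact Finset.sum_eq_zero fun l _ => (hcoeff i l).2
    -- Pointwise, this is the Lyapunov step plus twice the max-weight inequality; the arrival term
    -- disappears on integration by `hsum0`.
    have hstep := integral_mono_ae ((hl (T + 1)).add ((h.integrable_cost T).const_mul (2 * W)))
      (((hl T).add (hsumi.const_mul 2)).add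
        (integrable_const (lyapunovBound G L Amax + 2 * W * cost G x))) (by
        filter_upwards [ae_all_iff.2 ha.bound] with ω hω
        have h2 := lyapunov_succ_le h0 h1 hω (fun t => h.isVirtualFlow t ω) T
        have h3 := driftPairing_le_of_isMaxWeight (b := fun i l => (a T ω i l : ℝ))
          (destQueue_nonneg _ _ _ _ _) (nodeQueue_nonneg _ _ _) hx (h.virtual_flow T ω)
        simp only [Pi.add_apply]
        linarith)
    rw [integral_add' (hl (T + 1)) ((h.integrable_cost T).const_mul (2 * W)),
      integral_add' ((hl T).add (hsumi.const_mul 2)) (integrable_const _),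
      integral_add' (hl T) (hsumi.const_mul 2), integral_const_mul, integral_const_mul, hsum0,
      integral_const] at hstep
    rw [Finset.sum_range_succ]
    push_cast
    simp only [probReal_univ, one_smul] at hstep
    linarith

theorem IsFlowMatchingRun.hasAvg_integral_cost (h : IsFlowMatchingRun P ℱ G W gam a ν α D μ)
    (hν : ∀ᵐ ω ∂P, ∀ i j l, HasAvg (fun t => ν t ω i j l) (νbar ω i j l)) :
    HasAvg (fun t => ∫ ω, cost G (ν t ω) ∂P) (∫ ω, cost G (νbar ω) ∂P) := by
  refine hasAvg_integral (K := ∑ p ∈ G.E, G.e p.1 p.2 * G.C p.1 p.2) (fun t => ?_)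
    (ae_of_all _ fun ω t => ?_) (hν.mono fun ω hω => hasAvg_cost hω)
  · exact Finset.measurable_fun_sum _ fun p _ => (Finset.measurable_fun_sum _ fun l _ =>
      (h.virtual_adapted t p.1 p.2 l).mono (ℱ.le t) le_rfl).const_mul _
  · rw [abs_of_nonneg (cost_nonneg (h.isVirtualFlow t ω).nonneg)]
    exact Finset.sum_le_sum fun p _ => mul_le_mul_of_nonneg_left
      ((h.isVirtualFlow t ω).capacity p.1 p.2) (G.e_nonneg _ _)

theorem lyapunov_nonneg (G : Network V) (Ud : ℝ) (U : V → Fin L → ℝ) : 0 ≤ lyapunov G Ud U := by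
  unfold lyapunov
  positivity

/-- The virtual flow costs at most `O(1 / W)` more than any static flow. -/
theorem IsFlowMatchingRun.integral_cost_le (ha : IsArrivalProcess P G lam Amax a)
    (h : IsFlowMatchingRun P ℱ G W gam a ν α D μ) (h0 : 0 ≤ gam) (h1 : gam ≤ 1) (hW : 0 < W)
    (hx : IsStaticFlow G lam gam x)
    (hν : ∀ᵐ ω ∂P, ∀ i j l, HasAvg (fun t => ν t ω i j l) (νbar ω i j l)) :
    ∫ ω, cost G (νbar ω) ∂P ≤ cost G x + lyapunovBound G L Amax / 2 / W := by
  refine le_of_tendsto (h.hasAvg_integral_cost hν) ?_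
  filter_upwards [eventually_gt_atTop 0] with T hT
  have hT' : (0 : ℝ) < T := by exact_mod_cast hT
  have h2 := h.integral_lyapunov_le ha h0 h1 hx T
  have h3 : 0 ≤ ∫ ω, lyapunov G (destQueue G gam (fun s => a s ω) (fun s => ν s ω) T)
      (nodeQueue (fun s => a s ω) (fun s => ν s ω) T) ∂P :=
    integral_nonneg fun ω => lyapunov_nonneg _ _ _
  rw [div_le_iff₀ hT', ← mul_le_mul_iff_right₀ (show (0 : ℝ) < 2 * W by positivity)]
  -- Multiplying by `2 * W` matches the summed drift inequality; this produces the constant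
  -- `lyapunovBound / 2`.
  have e : 2 * W * ((cost G x + lyapunovBound G L Amax / 2 / W) * T)
      = (lyapunovBound G L Amax + 2 * W * cost G x) * T := by
    field_simp
    ring
  rw [e]
  linarith

/-- The average virtual flow is almost surely a static flow. -/
theorem IsFlowMatchingRun.isStaticFlow (ha : IsArrivalProcess P G lam Amax a)
    (h : IsFlowMatchingRun P ℱ G W gam a ν α D μ) (h0 : 0 ≤ gam) (h1 : gam ≤ 1) (hW : 0 < W)
    (hx : IsStaticFlow G lam gam x)
    (hν : ∀ᵐ ω ∂P, ∀ i j l, HasAvg (fun t => ν t ω i j l) (νbar ω i j l)) :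
    ∀ᵐ ω ∂P, IsStaticFlow G lam gam (νbar ω) := by
  have hνm : ∀ t i j l, Measurable fun ω => ν t ω i j l := fun t i j l =>
    (h.virtual_adapted t i j l).mono (ℱ.le t) le_rfl
  -- Costs are nonnegative and can be dropped. The resulting linear growth of the second moments
  -- holds for each virtual queue separately.
  have hlyap : ∀ T : ℕ, ∫ ω, lyapunov G (destQueue G gam (fun s => a s ω) (fun s => ν s ω) T)
      (nodeQueue (fun s => a s ω) (fun s => ν s ω) T) ∂P
      ≤ (lyapunovBound G L Amax + 2 * W * cost G x) * T := fun T => by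
    have h2 := h.integral_lyapunov_le ha h0 h1 hx T
    have h3 : 0 ≤ 2 * W * ∑ t ∈ Finset.range T, ∫ ω, cost G (ν t ω) ∂P :=
      mul_nonneg (by positivity) (Finset.sum_nonneg fun t _ =>
        integral_nonneg fun ω => cost_nonneg (h.isVirtualFlow t ω).nonneg)
    linarith
  -- By linearity and the law of large numbers, the average of the drift is the drift of `νbar` at
  -- the rates `lam`; its nonpositivity is the reliability constraint.
  have hd : ∀ᵐ ω ∂P, destDrift G gam lam (νbar ω) ≤ 0 := by
    refine average_nonpos_of_sq_growth
      (Δ := fun t ω => destDrift G gam (fun i l => (a t ω i l : ℝ)) (ν t ω))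
      (U := fun t ω => destQueue G gam (fun s => a s ω) (fun s => ν s ω) t)
      (M := driftBound G L Amax) (fun t => measurable_destDrift G gam (ha.meas t) (hνm t)) ?_
      (ae_of_all _ fun ω T => sum_destDrift_le_destQueue G gam _ _ T)
      (fun T ω => destQueue_nonneg _ _ _ _ _)
      (fun T => (h.memLp_destQueue ha h0 h1 T).integrable_sq)
      (fun T => (integral_mono (h.memLp_destQueue ha h0 h1 T).integrable_sq
        (h.integrable_lyapunov ha h0 h1 T) fun ω => ?_).trans (hlyap T)) ?_
    · filter_upwards [ae_all_iff.2 ha.bound] with ω hω t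
      exact abs_destDrift_le h0 h1 (hω t) (h.isVirtualFlow t ω)
    · exact le_add_of_nonneg_right (Finset.sum_nonneg fun i _ => Finset.sum_nonneg fun l _ =>
        sq_nonneg _)
    · filter_upwards [hν, ha.hasAvg] with ω h2 h3
      exact ((HasAvg.sum _ fun i _ => HasAvg.sum _ fun l _ => h3 i l).const_mul gam).sub
        (HasAvg.sum _ fun l _ => HasAvg.sum _ fun j _ => h2 j _ l)
  have hn : ∀ᵐ ω ∂P, ∀ i l, i ≠ G.d → nodeDrift lam (νbar ω) i l ≤ 0 := by
    refine ae_all_iff.2 fun i => ae_all_iff.2 fun l => ?_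
    by_cases hi : i = G.d
    · simp [hi]
    simp only [ne_eq, hi, not_false_eq_true, true_imp_iff]
    refine average_nonpos_of_sq_growth
      (Δ := fun t ω => nodeDrift (fun i l => (a t ω i l : ℝ)) (ν t ω) i l)
      (U := fun t ω => nodeQueue (fun s => a s ω) (fun s => ν s ω) t i l)
      (M := driftBound G L Amax) (fun t => measurable_nodeDrift (ha.meas t) (hνm t) i l) ?_
      (ae_of_all _ fun ω T => sum_nodeDrift_le_nodeQueue _ _ i l T)
      (fun T ω => nodeQueue_nonneg _ _ _ _ _)
      (fun T => (h.memLp_nodeQueue ha T i l).integrable_sq)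
      (fun T => (integral_mono (h.memLp_nodeQueue ha T i l).integrable_sq
        (h.integrable_lyapunov ha h0 h1 T) fun ω => ?_).trans (hlyap T)) ?_
    · filter_upwards [ae_all_iff.2 ha.bound] with ω hω t
      exact abs_nodeDrift_le (hω t) (h.isVirtualFlow t ω) i l
    · refine le_add_of_nonneg_of_le (sq_nonneg _) ?_
      refine le_trans ?_ (Finset.single_le_sum (f := fun i => ∑ l, _ ^ 2) (fun i _ =>
        Finset.sum_nonneg fun l _ => sq_nonneg _) (Finset.mem_erase.2 ⟨hi, Finset.mem_univ i⟩))
      exact Finset.single_le_sum (f := fun l => _ ^ 2) (fun l _ => sq_nonneg _)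
        (Finset.mem_univ l)
    · filter_upwards [hν, ha.hasAvg] with ω h2 h3
      exact ((HasAvg.geq (fun m => HasAvg.sum _ fun j _ => h2 i j m) l).sub
        (HasAvg.gtr (fun m => HasAvg.sum _ fun j _ => h2 j i m) l)).sub
        (HasAvg.geq (fun m => h3 i m) l)
  filter_upwards [hd, hn, hν] with ω h2 h3 h4
  refine ⟨isVirtualFlow_of_hasAvg (fun t => h.isVirtualFlow t ω) h4, fun i hi l => ?_,
    sub_nonpos.1 h2⟩
  have := h3 i l hi
  unfold nodeDrift at this
  unfold Conserves
  linarith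

end VirtualQueues

/-! ### Convergence of the computed routing probabilities. -/

section Routing

variable {V : Type*} {L : ℕ}

theorem empFlow_nonneg {ν : ℕ → Flow V L} (hν : ∀ t i j l, 0 ≤ ν t i j l) (t : ℕ) (i j : V)
    (l : Fin L) : 0 ≤ empFlow ν t i j l :=
  div_nonneg (Finset.sum_nonneg fun s _ => hν s i j l) (Nat.cast_nonneg _)

variable [Fintype V]

theorem routingProb_nonneg {x : Flow V L} (hx : ∀ i j l, 0 ≤ x i j l) (lam : V → Fin L → ℝ)
    (i : V) (l : Fin L) (j : V) : 0 ≤ routingProb x lam i l j :=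
  div_nonneg (hx i j l) (le_max_of_le_right (outflow_nonneg hx i l))

theorem routingProb_le_one {x : Flow V L} (hx : ∀ i j l, 0 ≤ x i j l) (lam : V → Fin L → ℝ)
    (i : V) (l : Fin L) (j : V) : routingProb x lam i l j ≤ 1 :=
  div_le_one_of_le₀ (le_max_of_le_right (flow_le_outflow hx i j l))
    (le_max_of_le_right (outflow_nonneg hx i l))

/-- Conservation in the limit removes the maximum from the limiting denominator, and positive supply
makes the quotient continuous there. -/
theorem tendsto_routingProb {x : ℕ → Flow V L} {xbar : Flow V L} {lam : ℕ → V → Fin L → ℝ}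
    {lambar : V → Fin L → ℝ} (hx : ∀ i j l, Tendsto (fun t => x t i j l) atTop (𝓝 (xbar i j l)))
    (hlam : ∀ i l, Tendsto (fun t => lam t i l) atTop (𝓝 (lambar i l))) {i : V} {l : Fin L}
    (hc : Conserves xbar lambar i l) (hs : 0 < supply xbar lambar i l) (j : V) :
    Tendsto (fun t => routingProb (x t) (lam t) i l j) atTop
      (𝓝 (xbar i j l / supply xbar lambar i l)) := by
  have hout : ∀ m, Tendsto (fun t => outflow (x t) i m) atTop (𝓝 (outflow xbar i m)) := fun m =>
    tendsto_finsetSum _ fun j _ => hx i j m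
  have hin : ∀ m, Tendsto (fun t => inflow (x t) i m) atTop (𝓝 (inflow xbar i m)) := fun m =>
    tendsto_finsetSum _ fun j _ => hx j i m
  have hsup : Tendsto (fun t => supply (x t) (lam t) i l) atTop (𝓝 (supply xbar lambar i l)) :=
    ((tendsto_finsetSum _ fun m _ => hin m).add (tendsto_finsetSum _ fun m _ => hlam i m)).sub
      (tendsto_finsetSum _ fun m _ => hout m)
  have hmax := hsup.max (hout l)
  rw [max_eq_left (conserves_iff_outflow_le_supply.1 hc)] at hmax
  exact (hx i j l).div hmax hs.ne'

end Routing

/-! ### The actual flow follows the virtual flow. -/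

section ActualFlow

variable {V : Type*} [Fintype V] [DecidableEq V] {L : ℕ} {Ω : Type*} {mΩ : MeasurableSpace Ω}
  {P : Measure Ω}
  {ℱ : Filtration ℕ mΩ} {G : Network V} {W gam : ℝ} {a : ℕ → Ω → V → Fin L → ℕ}
  {ν : ℕ → Ω → Flow V L} {α : ℕ → Ω → V → Fin L → V → ℝ}
  {D : ℕ → V → Fin L → ℕ → Ω → Option V} {μ : ℕ → Ω → Flow V L} {lam : V → Fin L → ℝ} {Amax : ℕ}
  {νbar : Ω → Flow V L}

/-- The routing probabilities in use were computed at the last update. -/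
theorem IsFlowMatchingRun.exists_last_update (h : IsFlowMatchingRun P ℱ G W gam a ν α D μ)
    (ω : Ω) (i : V) (l : Fin L) (t : ℕ) : ∃ s,
      α t ω i l = routingProb (empFlow (fun s => ν s ω) s) (empRate (fun s => a s ω) s) i l ∧
      ∀ r ≤ t, α r ω i l
        = routingProb (empFlow (fun s => ν s ω) r) (empRate (fun s => a s ω) r) i l → r ≤ s := by
  induction t with
  | zero =>
    rcases h.prob_rule 0 ω i l with h1 | ⟨h1, _⟩
    · exact ⟨0, h1, fun r hr _ => hr⟩
    · exact absurd h1 (lt_irrefl 0)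
  | succ t ih =>
    by_cases h1 : α (t + 1) ω i l = routingProb (empFlow (fun s => ν s ω) (t + 1))
        (empRate (fun s => a s ω) (t + 1)) i l
    · exact ⟨t + 1, h1, fun r hr _ => hr⟩
    · obtain ⟨s, hs1, hs2⟩ := ih
      have h2 := ((h.prob_rule (t + 1) ω i l).resolve_left h1).2.1
      rw [Nat.add_sub_cancel] at h2
      refine ⟨s, h2.trans hs1, fun r hr hr' => ?_⟩
      rcases Nat.lt_or_ge t r with h3 | h3
      · exact absurd (by rwa [Nat.le_antisymm hr h3] at hr') h1
      · exact hs2 r h3 hr'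

theorem IsFlowMatchingRun.prob_nonneg (h : IsFlowMatchingRun P ℱ G W gam a ν α D μ)
    (t : ℕ) (ω : Ω) (i : V) (l : Fin L) (j : V) : 0 ≤ α t ω i l j := by
  obtain ⟨s, hs, _⟩ := h.exists_last_update ω i l t
  rw [hs]
  exact routingProb_nonneg (empFlow_nonneg (fun t => (h.isVirtualFlow t ω).nonneg) s) _ _ _ _

theorem IsFlowMatchingRun.prob_le_one (h : IsFlowMatchingRun P ℱ G W gam a ν α D μ)
    (t : ℕ) (ω : Ω) (i : V) (l : Fin L) (j : V) : α t ω i l j ≤ 1 := by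
  obtain ⟨s, hs, _⟩ := h.exists_last_update ω i l t
  rw [hs]
  exact routingProb_le_one (empFlow_nonneg (fun t => (h.isVirtualFlow t ω).nonneg) s) _ _ _ _

/-- Updates occur infinitely often, so the time of the last update tends to infinity. Retained
probabilities are therefore values of the convergent computed sequence at late times. -/
theorem IsFlowMatchingRun.tendsto_prob (h : IsFlowMatchingRun P ℱ G W gam a ν α D μ) {ω : Ω}
    {x : Flow V L} {i : V} {l : Fin L} (hν : ∀ i j l, HasAvg (fun t => ν t ω i j l) (x i j l))
    (ha : ∀ i l, HasAvg (fun t => (a t ω i l : ℝ)) (lam i l)) (hc : Conserves x lam i l)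
    (hs : 0 < supply x lam i l)
    (hf : ∃ᶠ t in atTop, α t ω i l
      = routingProb (empFlow (fun s => ν s ω) t) (empRate (fun s => a s ω) t) i l) (j : V) :
    Tendsto (fun t => α t ω i l j) atTop (𝓝 (x i j l / supply x lam i l)) := by
  choose s hs1 hs2 using h.exists_last_update ω i l
  have hst : Tendsto s atTop atTop := by
    refine tendsto_atTop.2 fun N => ?_
    obtain ⟨r, hr, hr'⟩ := frequently_atTop.1 hf N
    filter_upwards [eventually_ge_atTop r] with t ht
    exact hr.trans (hs2 t r ht hr')
  refine ((tendsto_routingProb (x := empFlow fun s => ν s ω) (lam := empRate fun s => a s ω)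
    hν ha hc hs j).comp hst).congr fun t => ?_
  rw [hs1 t, Function.comp]

theorem IsFlowMatchingRun.actual_eq_natCast (h : IsFlowMatchingRun P ℱ G W gam a ν α D μ)
    (t : ℕ) (ω : Ω) (i j : V) (l : Fin L) : μ t ω i j l = ((if (i, j) ∈ G.E then
      ((Finset.range ⌊queue G (fun s => a s ω) (fun s => μ s ω) t i l⌋₊).filter
        (fun k => D t i l k ω = some j)).card else 0 : ℕ) : ℝ) := by
  rw [h.actual_flow]
  split_ifs <;> simp

theorem measurable_comp_natIndex {Ω : Type*} {m : MeasurableSpace Ω} {g : ℕ → Ω → ℝ}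
    {n : Ω → ℕ} (hg : ∀ k, Measurable (g k)) (hn : Measurable n) :
    Measurable fun ω => g (n ω) ω := by
  have h : Measurable fun q : ℕ × Ω => g q.1 q.2 := measurable_from_prod_countable_right hg
  exact h.comp (hn.prodMk measurable_id)

theorem measurable_card_filter {Ω : Type*} {m : MeasurableSpace Ω} {n : Ω → ℕ}
    (hn : Measurable n) {p : ℕ → Ω → Prop} [∀ k ω, Decidable (p k ω)]
    (hp : ∀ k, MeasurableSet {ω | p k ω}) :
    Measurable fun ω => (((Finset.range (n ω)).filter fun k => p k ω).card : ℝ) := by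
  refine measurable_comp_natIndex
    (g := fun N ω => (((Finset.range N).filter fun k => p k ω).card : ℝ)) (fun N => ?_) hn
  simp only [Finset.card_filter, Nat.cast_sum, Nat.cast_ite, Nat.cast_one, Nat.cast_zero]
  exact Finset.measurable_fun_sum _ fun k _ =>
    Measurable.ite (hp k) measurable_const measurable_const

/-- Each packet is sent to at most one node. -/
theorem sum_card_filter_some_le (n : ℕ) (f : ℕ → Option V) :
    ∑ j, ((Finset.range n).filter fun k => f k = some j).card ≤ n := by
  simp only [Finset.card_filter]
  rw [Finset.sum_comm]
  refine (Finset.sum_le_card_nsmul _ _ 1 fun k _ => ?_).trans (by simp)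
  rcases f k with _ | j
  · simp
  · simp

theorem IsFlowMatchingRun.actual_nonneg (h : IsFlowMatchingRun P ℱ G W gam a ν α D μ)
    (t : ℕ) (ω : Ω) (i j : V) (l : Fin L) : 0 ≤ μ t ω i j l := by
  rw [h.actual_eq_natCast]
  exact Nat.cast_nonneg _

theorem IsFlowMatchingRun.exists_outflow_eq (h : IsFlowMatchingRun P ℱ G W gam a ν α D μ)
    (t : ℕ) (ω : Ω) (i : V) (l : Fin L) : ∃ m : ℕ, outflow (μ t ω) i l = m ∧
      m ≤ ⌊queue G (fun s => a s ω) (fun s => μ s ω) t i l⌋₊ := by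
  refine ⟨∑ j, if (i, j) ∈ G.E then
      ((Finset.range ⌊queue G (fun s => a s ω) (fun s => μ s ω) t i l⌋₊).filter
        (fun k => D t i l k ω = some j)).card else 0, ?_, ?_⟩
  · simp only [outflow, h.actual_eq_natCast]
    rw [Nat.cast_sum]
  · refine (Finset.sum_le_sum fun j _ => ?_).trans
      (sum_card_filter_some_le _ fun k => D t i l k ω)
    split_ifs
    · exact le_rfl
    · exact Nat.zero_le _

theorem IsFlowMatchingRun.exists_inflow_eq (h : IsFlowMatchingRun P ℱ G W gam a ν α D μ)
    (t : ℕ) (ω : Ω) (i : V) (l : Fin L) : ∃ m : ℕ, inflow (μ t ω) i l = m := by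
  simp only [inflow, h.actual_eq_natCast, ← Nat.cast_sum]
  exact ⟨_, rfl⟩

/-- Flows count packets and arrivals are integers, so the floor in `actual_flow` discards nothing.
-/
theorem IsFlowMatchingRun.exists_queue_eq (h : IsFlowMatchingRun P ℱ G W gam a ν α D μ)
    (t : ℕ) (ω : Ω) (i : V) (l : Fin L) :
    ∃ n : ℕ, queue G (fun s => a s ω) (fun s => μ s ω) t i l = n := by
  induction t generalizing i l with
  | zero => exact ⟨0, by simp [queue]⟩
  | succ t ih =>
    by_cases hi : i = G.d
    · exact ⟨0, by rw [hi, queue_dest, Nat.cast_zero]⟩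
    rw [queue_succ G _ _ t hi]
    unfold succLife
    split_ifs with hl
    · obtain ⟨n, hn⟩ := ih i ⟨(l : ℕ) + 1, hl⟩
      obtain ⟨m, hm, hmn⟩ := h.exists_outflow_eq t ω i ⟨(l : ℕ) + 1, hl⟩
      rw [hn, Nat.floor_natCast] at hmn
      obtain ⟨m', hm'⟩ := h.exists_inflow_eq t ω i ⟨(l : ℕ) + 1, hl⟩
      refine ⟨n - m + m' + a t ω i l, ?_⟩
      rw [hn, hm, hm', Nat.cast_add, Nat.cast_add, Nat.cast_sub hmn]
    · exact ⟨a t ω i l, by simp⟩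

theorem IsFlowMatchingRun.natCast_floor_queue (h : IsFlowMatchingRun P ℱ G W gam a ν α D μ)
    (t : ℕ) (ω : Ω) (i : V) (l : Fin L) :
    (⌊queue G (fun s => a s ω) (fun s => μ s ω) t i l⌋₊ : ℝ)
      = queue G (fun s => a s ω) (fun s => μ s ω) t i l := by
  obtain ⟨n, hn⟩ := h.exists_queue_eq t ω i l
  rw [hn, Nat.floor_natCast]

theorem IsFlowMatchingRun.outflow_le_queue (h : IsFlowMatchingRun P ℱ G W gam a ν α D μ)
    (t : ℕ) (ω : Ω) (i : V) (l : Fin L) :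
    outflow (μ t ω) i l ≤ queue G (fun s => a s ω) (fun s => μ s ω) t i l := by
  obtain ⟨m, hm, hmn⟩ := h.exists_outflow_eq t ω i l
  rw [hm, ← h.natCast_floor_queue]
  exact_mod_cast hmn

theorem IsFlowMatchingRun.actual_le_queue (h : IsFlowMatchingRun P ℱ G W gam a ν α D μ)
    (t : ℕ) (ω : Ω) (i j : V) (l : Fin L) :
    μ t ω i j l ≤ queue G (fun s => a s ω) (fun s => μ s ω) t i l :=
  (flow_le_outflow (h.actual_nonneg t ω) i j l).trans (h.outflow_le_queue t ω i l)

theorem IsFlowMatchingRun.queue_le (ha : IsArrivalProcess P G lam Amax a)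
    (h : IsFlowMatchingRun P ℱ G W gam a ν α D μ) : ∀ᵐ ω ∂P, ∀ t i l,
      queue G (fun s => a s ω) (fun s => μ s ω) t i l ≤ queueBound V L Amax := by
  filter_upwards [ae_all_iff.2 ha.bound] with ω hω
  exact queue_le_queueBound G hω (fun t => h.actual_nonneg t ω) fun t => h.outflow_le_queue t ω

/-- The flow in slot `t` depends on the queue in slot `t`, which involves only earlier flows; hence
the strong induction. -/
theorem IsFlowMatchingRun.measurable_actual (h : IsFlowMatchingRun P ℱ G W gam a ν α D μ)
    (t : ℕ) (i j : V) (l : Fin L) : Measurable[ℱ (t + 1)] fun ω => μ t ω i j l := by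
  induction t using Nat.strong_induction_on generalizing i j l with
  | _ t ih =>
    have hq : Measurable[ℱ (t + 1)] fun ω =>
        queue G (fun s => a s ω) (fun s => μ s ω) t i l :=
      measurable_queue G t (fun s hs => h.measurable_arrivals (hs.trans (Nat.lt_succ_self t)))
        (fun s hs i j l => (ih s hs i j l).mono (ℱ.mono (by omega)) le_rfl) i l
    simp only [h.actual_flow]
    split_ifs
    · have hn : Measurable[ℱ (t + 1)] fun ω =>
          ⌊queue G (fun s => a s ω) (fun s => μ s ω) t i l⌋₊ := Nat.measurable_floor.comp hq
      exact measurable_card_filter hn fun k => h.decisions_observed t i l k (some j)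
    · exact measurable_const

theorem IsFlowMatchingRun.measurable_queue (h : IsFlowMatchingRun P ℱ G W gam a ν α D μ)
    (t : ℕ) (i : V) (l : Fin L) :
    Measurable[ℱ t] fun ω => queue G (fun s => a s ω) (fun s => μ s ω) t i l :=
  DelayNet.measurable_queue G t (fun _ hs => h.measurable_arrivals hs)
    (fun s hs i j l => (h.measurable_actual s i j l).mono (ℱ.mono hs) le_rfl) i l

/-- At the smallest lifetime the sum `lss` is empty, so a link that avoids the destination has no
positive term in its weight. -/
theorem IsFlowMatchingRun.virtual_lifetime_one (h : IsFlowMatchingRun P ℱ G W gam a ν α D μ)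
    (hW : 0 ≤ W) (t : ℕ) (ω : Ω) {i j : V} {l : Fin L} (hl : (l : ℕ) = 0) (hj : j ≠ G.d) :
    ν t ω i j l = 0 := by
  refine (h.virtual_flow t ω).positive i j l ?_
  have h1 : ∀ f : Fin L → ℝ, lss f l = 0 := fun f => by
    refine Finset.sum_eq_zero fun m hm => ?_
    have := Fin.lt_def.1 (Finset.mem_filter.1 hm).2
    omega
  have h2 := leq_nonneg (nodeQueue_nonneg (fun s => a s ω) (fun s => ν s ω) t i) l
  have h3 := mul_nonneg hW (G.e_nonneg i j)
  unfold weight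
  rw [if_neg hj, h1]
  linarith

variable [IsProbabilityMeasure P]

theorem IsFlowMatchingRun.measureReal_decision (h : IsFlowMatchingRun P ℱ G W gam a ν α D μ)
    (t : ℕ) (i j : V) (l : Fin L) (k : ℕ) {F : Set Ω} (hF : MeasurableSet[ℱ t] F) :
    P.real (F ∩ {ω | D t i l k ω = some j}) = ∫ ω in F, α t ω i l j ∂P := by
  simpa [decisionProb] using h.decision_law t F hF Set.univ {(i, l, k)} fun _ => some j

/-- For a fixed rank `k`, the presence of the packet is known at the beginning of the slot, and the
decision minus its probability is a martingale difference bounded by 1. -/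
theorem IsFlowMatchingRun.hasAvg_packet (h : IsFlowMatchingRun P ℱ G W gam a ν α D μ)
    (i j : V) (l : Fin L) (k : ℕ) : ∀ᵐ ω ∂P, HasAvg (fun t =>
      if k < ⌊queue G (fun s => a s ω) (fun s => μ s ω) t i l⌋₊ then
        (if D t i l k ω = some j then 1 else 0) - α t ω i l j else 0) 0 := by
  have hk : ∀ t, MeasurableSet[ℱ t]
      {ω | k < ⌊queue G (fun s => a s ω) (fun s => μ s ω) t i l⌋₊} := fun t =>
    (Nat.measurable_floor.comp (h.measurable_queue t i l)) (measurableSet_Ioi (a := k))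
  refine hasAvg_zero_of_martingale_difference ℱ (fun t => ?_) (fun t => ae_of_all _ fun ω => ?_)
    fun t F hF => ?_
  · exact Measurable.ite (ℱ.mono (Nat.le_succ t) _ (hk t)) ((Measurable.ite
      (h.decisions_observed t i l k (some j)) measurable_const measurable_const).sub
      ((h.prob_adapted t i l j).mono (ℱ.mono (Nat.le_succ t)) le_rfl)) measurable_const
  · have h0 := h.prob_nonneg t ω i l j
    have h1 := h.prob_le_one t ω i l j
    split_ifs <;> rw [abs_le] <;> constructor <;> linarith
  · have hD : MeasurableSet {ω | D t i l k ω = some j} :=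
      ℱ.le _ _ (h.decisions_observed t i l k (some j))
    have hFk := hF.inter (hk t)
    have hα : Integrable (fun ω => α t ω i l j) P := by
      refine Integrable.of_bound ((h.prob_adapted t i l j).mono (ℱ.le t)
        le_rfl).aestronglyMeasurable 1 (ae_of_all _ fun ω => ?_)
      rw [Real.norm_eq_abs, abs_of_nonneg (h.prob_nonneg t ω i l j)]
      exact h.prob_le_one t ω i l j
    have hDi : Integrable ({ω | D t i l k ω = some j}.indicator fun _ => (1 : ℝ)) P :=
      (integrable_const 1).indicator hD
    have e : (fun ω => if k < ⌊queue G (fun s => a s ω) (fun s => μ s ω) t i l⌋₊ then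
        (if D t i l k ω = some j then (1 : ℝ) else 0) - α t ω i l j else 0)
        = {ω | k < ⌊queue G (fun s => a s ω) (fun s => μ s ω) t i l⌋₊}.indicator
          (fun ω => {ω | D t i l k ω = some j}.indicator (fun _ => (1 : ℝ)) ω - α t ω i l j) := by
      ext ω
      simp [Set.indicator_apply]
    rw [e, setIntegral_indicator (ℱ.le t _ (hk t)), integral_sub hDi.integrableOn hα.integrableOn,
      setIntegral_indicator hD, ← h.measureReal_decision t i j l k hFk]
    simp

/-- The actual flow follows the routing probabilities on average. -/
theorem IsFlowMatchingRun.hasAvg_actual_sub (ha : IsArrivalProcess P G lam Amax a)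
    (h : IsFlowMatchingRun P ℱ G W gam a ν α D μ) :
    ∀ᵐ ω ∂P, ∀ i j l, (i, j) ∈ G.E → HasAvg (fun t => μ t ω i j l
      - queue G (fun s => a s ω) (fun s => μ s ω) t i l * α t ω i l j) 0 := by
  have hp : ∀ᵐ ω ∂P, ∀ i j l k, HasAvg (fun t =>
      if k < ⌊queue G (fun s => a s ω) (fun s => μ s ω) t i l⌋₊ then
        (if D t i l k ω = some j then 1 else 0) - α t ω i l j else 0) 0 :=
    ae_all_iff.2 fun i => ae_all_iff.2 fun j => ae_all_iff.2 fun l => ae_all_iff.2 fun k =>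
      h.hasAvg_packet i j l k
  filter_upwards [hp, h.queue_le ha] with ω h1 h2 i j l hij
  -- Queues are bounded, so finitely many ranks suffice; ranks beyond the current queue contribute
  -- zero.
  have h3 := HasAvg.sum (Finset.range ⌊queueBound V L Amax⌋₊) fun k _ => h1 i j l k
  rw [Finset.sum_const_zero] at h3
  refine h3.congr fun T => ?_
  congr 1
  refine Finset.sum_congr rfl fun t _ => ?_
  have hle : ⌊queue G (fun s => a s ω) (fun s => μ s ω) t i l⌋₊ ≤ ⌊queueBound V L Amax⌋₊ :=
    Nat.floor_le_floor (h2 t i l)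
  dsimp only
  rw [h.actual_flow, if_pos hij, ← h.natCast_floor_queue t ω i l, Nat.floor_natCast,
    ← Finset.sum_filter]
  have e : (Finset.range ⌊queueBound V L Amax⌋₊).filter
      (fun k => k < ⌊queue G (fun s => a s ω) (fun s => μ s ω) t i l⌋₊)
      = Finset.range ⌊queue G (fun s => a s ω) (fun s => μ s ω) t i l⌋₊ := by
    ext k
    simp only [Finset.mem_filter, Finset.mem_range]
    omega
  rw [e, Finset.sum_sub_distrib, Finset.sum_const, Finset.card_range, nsmul_eq_mul,
    Finset.card_filter]
  push_cast
  rfl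

/-- The actual flow has the same long-term average as the virtual flow. -/
theorem IsFlowMatchingRun.hasAvg_actual (ha : IsArrivalProcess P G lam Amax a)
    (h : IsFlowMatchingRun P ℱ G W gam a ν α D μ)
    (hν : ∀ᵐ ω ∂P, ∀ i j l, HasAvg (fun t => ν t ω i j l) (νbar ω i j l))
    (hst : ∀ᵐ ω ∂P, IsStaticFlow G lam gam (νbar ω)) :
    ∀ᵐ ω ∂P, ∀ i j l, HasAvg (fun t => μ t ω i j l) (νbar ω i j l) := by
  filter_upwards [h.hasAvg_actual_sub ha, hν, hst, ha.hasAvg, h.queue_le ha, h.prob_updated]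
    with ω hsub hν hst ha hqb hupd
  have hq0 : ∀ t i l, 0 ≤ queue G (fun s => a s ω) (fun s => μ s ω) t i l := fun t i l =>
    (outflow_nonneg (h.actual_nonneg t ω) i l).trans (h.outflow_le_queue t ω i l)
  -- Downward induction on the lifetime, because the mean queue at `l` is determined by the actual
  -- flows of larger lifetimes.
  suffices H : ∀ k : ℕ, ∀ l : Fin L, L ≤ l + k →
      ∀ i j, HasAvg (fun t => μ t ω i j l) (νbar ω i j l) from
    fun i j l => H L l (Nat.le_add_left _ _) i j
  intro k
  induction k with
  | zero => intro l hl; have := l.isLt; omega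
  | succ k ih =>
    intro l hl i j
    have ih' : ∀ m, l < m → ∀ i j, HasAvg (fun t => μ t ω i j m) (νbar ω i j m) :=
      fun m hm => ih m (by have := Fin.lt_def.1 hm; omega)
    by_cases hij : (i, j) ∈ G.E
    swap
    · simp only [h.actual_flow, hij, if_false, hst.virtual.link i j l hij]
      exact hasAvg_const 0
    by_cases hi : i = G.d
    · have h1 : ∀ t, μ t ω i j l = 0 := fun t => by
        refine le_antisymm ((h.actual_le_queue t ω i j l).trans ?_) (h.actual_nonneg t ω i j l)
        rw [hi, queue_dest]
      simp only [h1]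
      rw [hi, hst.virtual.dest]
      exact hasAvg_const 0
    have hq : HasAvg (fun t => queue G (fun s => a s ω) (fun s => μ s ω) t i l)
        (supply (νbar ω) lam i l) :=
      hasAvg_queue (q := fun t l => queue G (fun s => a s ω) (fun s => μ s ω) t i l)
        (o := fun t l => outflow (μ t ω) i l) (n := fun t l => inflow (μ t ω) i l)
        (fun t l => queue_succ G _ _ t hi l) (fun l => ha i l) l
        (fun m hm => HasAvg.sum _ fun j _ => ih' m hm i j)
        fun m hm => HasAvg.sum _ fun j _ => ih' m hm j i
    have hcons := hst.conserves i hi l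
    have hout := conserves_iff_outflow_le_supply.1 hcons
    have hle := (flow_le_outflow hst.virtual.nonneg i j l).trans hout
    -- Without supply the probabilities may fail to converge, but then the mean queue is zero and it
    -- dominates the flow. With positive supply, the mean queue cancels the limiting denominator.
    rcases ((hst.virtual.nonneg i j l).trans hle).eq_or_lt with hs | hs
    · rw [← hs] at hq hle
      rw [le_antisymm hle (hst.virtual.nonneg i j l)]
      exact hq.squeeze_zero (fun t => h.actual_nonneg t ω i j l)
        fun t => h.actual_le_queue t ω i j l
    · have h1 := HasAvg.mul_bounded (h.tendsto_prob hν ha hcons hs (hupd i l) j) hq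
        (K := queueBound V L Amax) fun t => by
          rw [abs_of_nonneg (hq0 t i l)]
          exact hqb t i l
      rw [mul_div_cancel₀ _ hs.ne'] at h1
      simpa using (hsub i j l hij).add h1

/-- The virtual flow vanishes on these links, so the routing probabilities do as well, retained ones
included. The conclusion is only almost sure, since decisions of probability zero are not excluded
pointwise. -/
theorem IsFlowMatchingRun.actual_lifetime_one (h : IsFlowMatchingRun P ℱ G W gam a ν α D μ)
    (hW : 0 ≤ W) (t : ℕ) :
    ∀ᵐ ω ∂P, ∀ i j (l : Fin L), (l : ℕ) = 0 → j ≠ G.d → μ t ω i j l = 0 := by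
  refine ae_all_iff.2 fun i => ae_all_iff.2 fun j => ae_all_iff.2 fun l => ?_
  by_cases hl : (l : ℕ) = 0
  swap
  · simp [hl]
  by_cases hj : j = G.d
  · simp [hj]
  have hα : ∀ ω, α t ω i l j = 0 := fun ω => by
    obtain ⟨s, hs, _⟩ := h.exists_last_update ω i l t
    simp [hs, routingProb, empFlow, h.virtual_lifetime_one hW _ ω hl hj]
  have hD : ∀ᵐ ω ∂P, ∀ k, D t i l k ω ≠ some j := ae_all_iff.2 fun k => by
    have h1 := h.measureReal_decision t i j l k MeasurableSet.univ
    simp only [hα, integral_zero, Set.univ_inter] at h1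
    rw [ae_iff]
    simpa [measureReal_eq_zero_iff] using h1
  filter_upwards [hD] with ω hω _ _
  simp [h.actual_flow, hω]

/-- The decisions of the algorithm are feasible. -/
theorem IsFlowMatchingRun.isFeasible (ha : IsArrivalProcess P G lam Amax a)
    (h : IsFlowMatchingRun P ℱ G W gam a ν α D μ) (hW : 0 ≤ W)
    (hν : ∀ᵐ ω ∂P, ∀ i j l, HasAvg (fun t => ν t ω i j l) (νbar ω i j l))
    (hst : ∀ᵐ ω ∂P, IsStaticFlow G lam gam (νbar ω)) :
    IsFeasible P G lam gam a μ (fun i j l => ∫ ω, νbar ω i j l ∂P) := by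
  have hbi : ∀ i j l, Integrable (fun ω => νbar ω i j l) P := fun i j l =>
    integrable_of_hasAvg (fun t => (h.virtual_adapted t i j l).mono (ℱ.le t) le_rfl)
      (K := G.C i j) (ae_of_all _ fun ω t => by
        rw [abs_of_nonneg ((h.isVirtualFlow t ω).nonneg i j l)]
        exact (h.isVirtualFlow t ω).le_capacity i j l) (hν.mono fun ω hω => hω i j l)
  have hμm : ∀ t i j l, Measurable fun ω => μ t ω i j l := fun t i j l =>
    (h.measurable_actual t i j l).mono (ℱ.le _) le_rfl
  refine ⟨hμm, fun t => ae_of_all _ fun ω => h.actual_nonneg t ω,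
    fun t => ae_of_all _ fun ω i j l hij => by simp [h.actual_flow, hij],
    h.actual_lifetime_one hW, fun t => ae_of_all _ fun ω => h.outflow_le_queue t ω,
    fun i j l => ?_, ?_, fun i j _ => ?_⟩
  · refine hasAvg_integral (K := queueBound V L Amax) (fun t => hμm t i j l) ?_
      ((h.hasAvg_actual ha hν hst).mono fun ω hω => hω i j l)
    filter_upwards [h.queue_le ha] with ω hω t
    rw [abs_of_nonneg (h.actual_nonneg t ω i j l)]
    exact (h.actual_le_queue t ω i j l).trans (hω t i l)
  · have h1 := integral_mono_ae (integrable_const (gam * ∑ i, ∑ l, lam i l))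
      (integrable_finsetSum Finset.univ fun l _ =>
        integrable_finsetSum Finset.univ fun j _ => hbi j G.d l)
      (hst.mono fun ω hω => hω.reliable)
    rw [integral_finsetSum _ fun l _ => integrable_finsetSum _ fun j _ => hbi j G.d l] at h1
    simp only [integral_finsetSum _ fun j _ => hbi j G.d _, integral_const, probReal_univ,
      one_smul] at h1
    exact h1
  -- Like reliability, the capacity constraint is linear and passes from almost every `νbar ω` to
  -- the mean.
  · have h1 := integral_mono_ae (integrable_finsetSum Finset.univ fun l _ => hbi i j l)
      (integrable_const (G.C i j)) (hst.mono fun ω hω => hω.virtual.capacity i j)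
    rw [integral_finsetSum _ fun l _ => hbi i j l] at h1
    simpa using h1

theorem IsFlowMatchingRun.hasAvg_integral_actual_cost (ha : IsArrivalProcess P G lam Amax a)
    (h : IsFlowMatchingRun P ℱ G W gam a ν α D μ)
    (hμ : ∀ᵐ ω ∂P, ∀ i j l, HasAvg (fun t => μ t ω i j l) (νbar ω i j l)) :
    HasAvg (fun t => ∫ ω, cost G (μ t ω) ∂P) (∫ ω, cost G (νbar ω) ∂P) := by
  refine hasAvg_integral (K := ∑ p ∈ G.E, G.e p.1 p.2 * ∑ _l : Fin L, queueBound V L Amax)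
    (fun t => ?_) ?_ (hμ.mono fun ω hω => hasAvg_cost hω)
  · exact Finset.measurable_fun_sum _ fun p _ => (Finset.measurable_fun_sum _ fun l _ =>
      (h.measurable_actual t p.1 p.2 l).mono (ℱ.le _) le_rfl).const_mul _
  · filter_upwards [h.queue_le ha] with ω hω t
    rw [abs_of_nonneg (cost_nonneg (h.actual_nonneg t ω))]
    exact Finset.sum_le_sum fun p _ => mul_le_mul_of_nonneg_left (Finset.sum_le_sum fun l _ =>
      (h.actual_le_queue t ω p.1 p.2 l).trans (hω t p.1 l)) (G.e_nonneg _ _)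

end ActualFlow

end DelayNet

/-! ### Conclusion. -/

open DelayNet
theorem proposition4 {V : Type*} [Fintype V] [DecidableEq V] (G : Network V) (L Amax : ℕ) :
    ∃ B : ℝ, ∀ (lam : V → Fin L → ℝ) (gam : ℝ), (lam, gam) ∈ stabilityInterior G L →
      ∀ W : ℝ, 0 < W →
      ∀ {Ω : Type*} {mΩ : MeasurableSpace Ω} (P : Measure Ω) [IsProbabilityMeasure P]
        (ℱ : Filtration ℕ mΩ) (a : ℕ → Ω → V → Fin L → ℕ) (ν : ℕ → Ω → Flow V L)
        (α : ℕ → Ω → V → Fin L → V → ℝ) (D : ℕ → V → Fin L → ℕ → Ω → Option V)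
        (μ : ℕ → Ω → Flow V L) (νbar : Ω → Flow V L),
      IsArrivalProcess P G lam Amax a →
      IsFlowMatchingRun P ℱ G W gam a ν α D μ →
      (∀ᵐ ω ∂P, ∀ i j l, HasAvg (fun t => ν t ω i j l) (νbar ω i j l)) →
        IsFeasible P G lam gam a μ (fun i j l => ∫ ω, νbar ω i j l ∂P) ∧
        (∀ᵐ ω ∂P, ∀ i j l, HasAvg (fun t => μ t ω i j l) (νbar ω i j l)) ∧
        (∀ᵐ ω ∂P, HasAvg (fun t => cost G (μ t ω)) (cost G (νbar ω))) ∧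
        HasAvg (fun t => ∫ ω, cost G (μ t ω) ∂P) (∫ ω, cost G (νbar ω) ∂P) ∧
        ∫ ω, cost G (νbar ω) ∂P ≤ optCost G (lam, gam) + B / W := by
  refine ⟨lyapunovBound G L Amax / 2, ?_⟩
  intro lam gam hp W hW Ω mΩ P _ ℱ a ν α D μ νbar ha h hν
  obtain ⟨⟨_, _, h0, h1⟩, hnhds⟩ := hp
  have hne : (flowSpace G (lam, gam)).Nonempty :=
    (mem_of_mem_nhdsWithin (show (lam, gam) ∈ paramSpace G L from ⟨‹_›, ‹_›, h0, h1⟩) hnhds).2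
  -- Competing decisions may live on another probability space, with another arrival process and
  -- another bound; being static depends only on `lam` and `gam`.
  have hstatic : ∀ x ∈ flowSpace G (lam, gam), IsStaticFlow G lam gam x := by
    rintro x ⟨Ω', _, P', Amax', a', x', _, ha', hx'⟩
    exact hx'.isStaticFlow ha'
  obtain ⟨x₀, hx₀⟩ := hne
  have hst := h.isStaticFlow ha h0 h1 hW (hstatic x₀ hx₀) hν
  have hμ := h.hasAvg_actual ha hν hst
  refine ⟨h.isFeasible ha hW.le hν hst, hμ, hμ.mono fun ω hω => hasAvg_cost hω,
    h.hasAvg_integral_actual_cost ha hμ, ?_⟩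
  rw [← sub_le_iff_le_add]
  -- Nonemptiness ensures that `sInf` is a true infimum and not the default value at the empty set.
  refine le_csInf ⟨_, x₀, hx₀, rfl⟩ ?_
  rintro _ ⟨x, hx, rfl⟩
  exact sub_le_iff_le_add.2 (h.integral_cost_le ha h0 h1 hW (hstatic x hx) hν)
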